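/- Let $(A,H,D)$ be an even spectral triple: $A$ is a complex algebra (not necessarily unital) acting by bounded even operators on a $\mathbb{Z}_2$-graded Hilbert space $H$, and $D$ is an odd unbounded self-adjoint operator on $H$ such that, with $\Delta=D^2$, for all $a\in A$ the operator $a(1+\Delta)^{-1}$ is compact, $a\cdot\mathrm{dom}(D)\subset\mathrm{dom}(D)$, and $[D,a]$ is bounded. Assume that $D$ is Fredholm and let $\Pi$ be the orthogonal projection onto $\ker D$. For $\mathrm{Re}(z)>0$ let $\Delta^{-z}$ be the complex power, equal to $\mu^{-z}$ on the strictly positive spectrum of $\Delta$ and to $0$ on $\ker\Delta$. Assume that $A$ preserves $H^\infty=\bigcap_{s\ge1}\mathrm{dom}(\Delta^s)$, and let $\mathcal{D}(A,D)$ be the smallest algebra of operators on $H^\infty$ that contains $A$ and $[D,A]$ and is closed under $X\mapsto[\Delta,X]$. Assume that $\mathcal{D}(A,D)=\bigcup_{q\in\mathbb{Z}_{\ge0}}\mathcal{D}_q$ is an increasing algebra filtration ($\mathcal D_q\mathcal D_{q'}\subset\mathcal D_{q+q'}$, $A\subset\mathcal D_0$) and $r\ge2$ is an even integer such that $[\Delta,\mathcal{D}_q]\subset\mathcal{D}_{q+r-1}$,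 $[D,A]\subset\mathcal{D}_{r/2-1}$, and for every $X\in\mathcal{D}_q$ there is $\varepsilon>0$ with $\varepsilon\|Xv\|\le\|v\|+\|\Delta^{q/r}v\|$ for all $v\in H^\infty$. Assume finite analytic dimension $n$: $n$ is the least real number $\ge0$ such that for all $q$, all $X\in\mathcal{D}_q$ and all $z$ with $\mathrm{Re}(z)>\frac{q+n}{r}$ the operator $X\Delta^{-z}$ extends to a trace class operator on $H$. Assume also the analytic continuation property: for each such $X$ the function $z\mapsto\mathrm{Tr}(X\Delta^{-z})$ extends to a meromorphic function on $\mathbb{C}$. Let $p$ be even, $0\le p\le n$, and let $a_0,\dots,a_p\in A$. For $k=(k_1,\dots,k_p)\in(\mathbb{Z}_{\ge0})^p$ put $|k|=k_1+\cdots+k_p$, $k!=k_1!\cdots k_p!$, $X^{(\ell)}=\mathrm{ad}_\Delta^\ell(X)$ and $$P_k=a_0[D,a_1]^{(k_1)}\cdots[D,a_p]^{(k_p)},\qquad c'_{pk}=\frac{(-1)^{|k|}}{k!\,(k_1+1)(k_1+k_2+2)\cdots(k_1+\cdots+k_p+p)},\qquad c_{pk}=\Gamma\!\left(\tfrac p2+|k|\right)c'_{pk}\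 \ (p>0).$$ With $\mathrm{Tr}_s$ the supertrace and residues taken of meromorphic continuations, the components of the residue cocycle are $$\varphi_0(a_0)=\mathrm{Res}_{z=0}\big(\Gamma(z)\mathrm{Tr}_s(a_0\Delta^{-z})\big)+\mathrm{Tr}_s(a_0\Pi),\qquad \varphi_p(a_0,\dots,a_p)=\sum_{|k|\le n-p}c_{pk}\,\mathrm{Res}_{z=\frac p2+|k|}\mathrm{Tr}_s(P_k\Delta^{-z})\quad(p>0).$$ Suppose that for every $k$ with $|k|\le n-p$ there are a real number $N_k$ and complex numbers $\psi_{k,s}$ ($s=0,1,2,\dots$) such that, as $t\to0^+$, $$\mathrm{Tr}_s(P_ke^{-t\Delta})\sim t^{-N_k}\sum_{s\ge0}t^s\psi_{k,s},$$ that is, for every integer $M\ge0$ the difference of the left side and $\sum_{s=0}^{M}t^{s-N_k}\psi_{k,s}$ is $o(t^{M-N_k})$. Then $$\varphi_p(a_0,\dots,a_p)=\sum_{|k|\le n-p}c'_{pk}\,\psi_{k,\,N_k-\frac p2-|k|},$$ where $\psi_{k,s}$ is read as $0$ if $s$ is not one of $0,1,2,\dots$. -/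

import Mathlib

open Filter Topology Asymptotics

noncomputable section

namespace ResidueCocycle

/-! ### Unbounded operators -/

section Unbounded

variable {H : Type*} [NormedAddCommGroup H] [InnerProductSpace ℂ H]

/-- The composition `S ∘ T` of unbounded operators, on its natural domain
`{v ∈ dom T | T v ∈ dom S}`. -/
def compPMap (S T : H →ₗ.[ℂ] H) : H →ₗ.[ℂ] H where
  domain := (S.domain.comap T.toFun).map T.domain.subtype
  toFun :=
    { toFun := fun v =>
        S ⟨T ⟨v, by obtain ⟨w, -, hw⟩ := v.2; rw [← hw]; exact w.2⟩, by
          obtain ⟨v, w, hw, rfl⟩ := v; exact hw⟩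
      map_add' := by
        rintro ⟨_, v, hv, rfl⟩ ⟨_, w, hw, rfl⟩
        rw [← LinearPMap.map_add]
        congr 1
        ext
        exact T.map_add v w
      map_smul' := by
        rintro c ⟨_, v, hv, rfl⟩
        rw [RingHom.id_apply, ← LinearPMap.map_smul]
        congr 1
        ext
        exact T.map_smul c v }

/-- The power `T ^ s` of an unbounded operator, on its natural domain. -/
def powPMap (T : H →ₗ.[ℂ] H) : ℕ → (H →ₗ.[ℂ] H)
  | 0 => (LinearMap.id : H →ₗ[ℂ] H).toPMap ⊤
  | s + 1 => compPMap (powPMap T s) T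

/-- `Δ = D²`. -/
def laplace (D : H →ₗ.[ℂ] H) : H →ₗ.[ℂ] H := compPMap D D

/-- `H^∞ = ⋂_{s ≥ 1} dom (Δ ^ s)`. -/
def smooth (D : H →ₗ.[ℂ] H) : Submodule ℂ H :=
  ⨅ s : ℕ, (powPMap (laplace D) (s + 1)).domain

theorem mem_compPMap_domain {S T : H →ₗ.[ℂ] H} {v : H} :
    v ∈ (compPMap S T).domain ↔ ∃ hv : v ∈ T.domain, T ⟨v, hv⟩ ∈ S.domain := by
  constructor
  · rintro ⟨w, hw, rfl⟩
    exact ⟨w.2, hw⟩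
  · rintro ⟨hv, h⟩
    exact ⟨⟨v, hv⟩, h, rfl⟩

theorem compPMap_apply {S T : H →ₗ.[ℂ] H} {v : H} (hv : v ∈ T.domain)
    (h : T ⟨v, hv⟩ ∈ S.domain) (h' : v ∈ (compPMap S T).domain) :
    compPMap S T ⟨v, h'⟩ = S ⟨T ⟨v, hv⟩, h⟩ := rfl

theorem mem_laplace_domain {D : H →ₗ.[ℂ] H} {v : H} :
    v ∈ (laplace D).domain ↔ ∃ hv : v ∈ D.domain, D ⟨v, hv⟩ ∈ D.domain :=
  mem_compPMap_domain

theorem apply_mem_pow {D : H →ₗ.[ℂ] H} (s : ℕ) :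
    ∀ {v : H} (hv : v ∈ D.domain), v ∈ (powPMap (laplace D) (s + 1)).domain →
      D ⟨v, hv⟩ ∈ (powPMap (laplace D) s).domain := by
  induction s with
  | zero => intro v hv _; exact Submodule.mem_top
  | succ s ih =>
    intro v hv h
    obtain ⟨h1, h2⟩ := mem_compPMap_domain.1 h
    obtain ⟨h3, h4⟩ := mem_laplace_domain.1 h1
    obtain ⟨h5, -⟩ := mem_compPMap_domain.1 h2
    obtain ⟨h6, -⟩ := mem_laplace_domain.1 h5
    exact mem_compPMap_domain.2 ⟨mem_laplace_domain.2 ⟨h4, h6⟩, ih h6 h2⟩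

theorem smooth_le_domain {D : H →ₗ.[ℂ] H} {v : H} (hv : v ∈ smooth D) : v ∈ D.domain := by
  have h := (Submodule.mem_iInf _).1 hv 0
  obtain ⟨h1, -⟩ := mem_compPMap_domain.1 h
  exact (mem_laplace_domain.1 h1).1

theorem apply_mem_smooth {D : H →ₗ.[ℂ] H} {v : H} (hv : v ∈ smooth D) :
    D ⟨v, smooth_le_domain hv⟩ ∈ smooth D :=
  (Submodule.mem_iInf _).2 fun s =>
    apply_mem_pow (s + 1) _ ((Submodule.mem_iInf _).1 hv (s + 1))

/-- `D` as an operator on `H^∞`. -/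
def dOp (D : H →ₗ.[ℂ] H) : Module.End ℂ (smooth D) where
  toFun v := ⟨D ⟨v, smooth_le_domain v.2⟩, apply_mem_smooth v.2⟩
  map_add' v w := by
    ext
    exact D.map_add ⟨v, smooth_le_domain v.2⟩ ⟨w, smooth_le_domain w.2⟩
  map_smul' c v := by
    ext
    exact D.map_smul c ⟨v, smooth_le_domain v.2⟩

/-- `Δ = D²` as an operator on `H^∞`. -/
def laplaceOp (D : H →ₗ.[ℂ] H) : Module.End ℂ (smooth D) := dOp D * dOp D

/-- The kernel of `D`, as a subspace of `H`. -/
def kernel (D : H →ₗ.[ℂ] H) : Submodule ℂ H :=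
  (LinearMap.ker D.toFun).map D.domain.subtype

/-- An unbounded operator is Fredholm: finite-dimensional kernel, closed range, and
finite-dimensional cokernel. -/
def IsFredholm (D : H →ₗ.[ℂ] H) : Prop :=
  FiniteDimensional ℂ (kernel D) ∧
  IsClosed (LinearMap.range D.toFun : Set H) ∧
  FiniteDimensional ℂ (H ⧸ LinearMap.range D.toFun)

open scoped Classical in
/-- The bounded operator `(1 + D²)⁻¹`: the bounded two-sided inverse of `1 + D²`. It exists and is
unique whenever `D` is self-adjoint (the value `0` otherwise is a placeholder). -/
def invOneAddSq (D : H →ₗ.[ℂ] H) : H →L[ℂ] H :=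
  if h : ∃ R : H →L[ℂ] H,
      (∀ v, ∃ hv : R v ∈ (laplace D).domain, R v + laplace D ⟨R v, hv⟩ = v) ∧
      (∀ u : (laplace D).domain, R (u + laplace D u) = u)
  then h.choose else 0

variable [CompleteSpace H]

/-- The functional calculus `f(Δ)` of the non-negative self-adjoint operator `Δ = D²`, for
functions `f` that are continuous on the spectrum of `Δ` and vanish at infinity. It is obtained from
the continuous functional calculus of the bounded self-adjoint operator `(1 + Δ)⁻¹`, whose
spectral parameter is `x = (1 + μ)⁻¹` for `μ` in the spectrum of `Δ`, and `x = 0` for `μ = ∞`. -/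
def laplaceCalc (D : H →ₗ.[ℂ] H) (f : ℝ → ℂ) : H →L[ℂ] H :=
  cfc (fun x : ℂ => if x = 0 then 0 else f (x.re⁻¹ - 1)) (invOneAddSq D)

/-- The heat operator `e^{-tΔ}`, for `t > 0`. -/
def heat (D : H →ₗ.[ℂ] H) (t : ℝ) : H →L[ℂ] H :=
  laplaceCalc D fun μ => (Real.exp (-(t * μ)) : ℂ)

open scoped Classical in
/-- The complex power `Δ^{-z}`, for `Re z > 0` and `D` Fredholm: it is `μ^{-z}` on the strictly
positive part of the spectrum, and vanishes on the kernel of `Δ`. (As `D` is Fredholm, `0` is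
isolated in the spectrum of `Δ`.) -/
def cpowNeg (D : H →ₗ.[ℂ] H) (z : ℂ) : H →L[ℂ] H :=
  laplaceCalc D fun μ => if μ = 0 then 0 else (μ : ℂ) ^ (-z)

open scoped Classical in
/-- The power `Δ^s v` for real `s ≥ 0` and `v ∈ H^∞`, written as `Δ^{s - m} (Δ^m v)`
with `m = ⌊s⌋ + 1`. -/
def posPow (D : H →ₗ.[ℂ] H) (s : ℝ) (v : smooth D) : H :=
  if s = 0 then v
  else cpowNeg D ((⌊s⌋₊ : ℂ) + 1 - s) ((laplaceOp D ^ (⌊s⌋₊ + 1)) v : smooth D)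

end Unbounded

/-! ### Trace class operators and the trace -/

section TraceClass

variable {H : Type*} [NormedAddCommGroup H] [InnerProductSpace ℂ H] [CompleteSpace H]

/-- `S` is a trace class (nuclear) operator on the Hilbert space `H`: it is a sum
`∑ ⟨y i, ·⟩ x i` of rank one operators with `∑ ‖x i‖ ‖y i‖ < ∞`. -/
def IsTraceClass (S : H →L[ℂ] H) : Prop :=
  ∃ x y : ℕ → H, Summable (fun i => ‖x i‖ * ‖y i‖) ∧
    ∀ v, HasSum (fun i => inner ℂ (y i) v • x i) (S v)

/-- The trace `∑ ⟨e i, S (e i)⟩` with respect to an orthonormal basis of `H`; for trace class `S`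
the sum converges absolutely and does not depend on the basis. -/
def opTrace (S : H →L[ℂ] H) : ℂ :=
  ∑' i, inner ℂ ((exists_hilbertBasis ℂ H).choose_spec.choose i)
    (S ((exists_hilbertBasis ℂ H).choose_spec.choose i))

/-- The bounded operator `S` extends the composition `X B` of a bounded operator `B` with an
operator `X` defined on the subspace `V`; the domain of `X B` is `{v | B v ∈ V}`. -/
def ExtendsComp {V : Submodule ℂ H} (X : Module.End ℂ V) (B S : H →L[ℂ] H) : Prop :=
  ∀ (v : H) (hv : B v ∈ V), S v = X ⟨B v, hv⟩

open scoped Classical in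
/-- The extension by continuity of `X B` to a bounded operator on `H` (`0` if there is none). -/
def extComp {V : Submodule ℂ H} (X : Module.End ℂ V) (B : H →L[ℂ] H) : H →L[ℂ] H :=
  if h : ∃ S : H →L[ℂ] H, ExtendsComp X B S then h.choose else 0

end TraceClass

/-! ### Residues -/

/-- The residue at `z₀` of a function that is meromorphic at `z₀`: the integral
`(2πi)⁻¹ ∮ f(z) dz` over all sufficiently small circles around `z₀`. -/
def residue (f : ℂ → ℂ) (z₀ : ℂ) : ℂ :=
  limUnder (𝓝[>] (0 : ℝ)) fun ρ =>
    (2 * Real.pi * Complex.I)⁻¹ * ∮ z in C(z₀, ρ), f z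

/-- `F` is a meromorphic continuation of `f` from some right half-plane to a right half-plane that
contains `z₀`. -/
def IsMeromorphicContinuation (f : ℂ → ℂ) (z₀ : ℂ) (F : ℂ → ℂ) : Prop :=
  ∃ σ σ' : ℝ, σ' < z₀.re ∧ MeromorphicOn F {z | σ' < z.re} ∧ ∀ z : ℂ, σ < z.re → F z = f z

open scoped Classical in
/-- The residue at `z₀` of the meromorphic continuation of `f`, where only the values of `f` in a
right half-plane matter. By the identity theorem all continuations have the same residue. -/
def contResidue (f : ℂ → ℂ) (z₀ : ℂ) : ℂ :=
  if h : ∃ F, IsMeromorphicContinuation f z₀ F then residue h.choose z₀ else 0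

/-! ### Even spectral triples -/

/-- An even spectral triple `(A, H, D)`, where the algebra `A` need not have a unit. The grading
operator `γ` is `1` on the even and `-1` on the odd part of `H`. -/
structure EvenSpectralTriple (A H : Type*) [NonUnitalRing A] [Module ℂ A]
    [NormedAddCommGroup H] [InnerProductSpace ℂ H] [CompleteSpace H] where
  /-- The grading operator. -/
  γ : H →L[ℂ] H
  /-- The representation. -/
  π : A →ₙₐ[ℂ] (H →L[ℂ] H)
  /-- The unbounded operator. -/
  D : H →ₗ.[ℂ] H
  γ_selfAdjoint : IsSelfAdjoint γ
  γ_sq : γ * γ = 1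
  π_even : ∀ a, γ * π a = π a * γ
  D_selfAdjoint : IsSelfAdjoint D
  D_odd : ∀ v : D.domain, ∃ hv : γ v ∈ D.domain, D ⟨γ v, hv⟩ = -γ (D v)
  compact : ∀ a, IsCompactOperator (π a * invOneAddSq D)
  π_domain : ∀ a, ∀ v ∈ D.domain, π a v ∈ D.domain
  bounded_comm : ∀ a, ∃ C : ℝ, ∀ v : D.domain,
    ‖D ⟨π a v, π_domain a v v.2⟩ - π a (D v)‖ ≤ C * ‖(v : H)‖

namespace EvenSpectralTriple

variable {A H : Type*} [NonUnitalRing A] [Module ℂ A]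
  [NormedAddCommGroup H] [InnerProductSpace ℂ H] [CompleteSpace H]
  (T : EvenSpectralTriple A H)

theorem isClosed_kernel : IsClosed (kernel T.D : Set H) := by
  have h : T.D.IsClosed := T.D_selfAdjoint.isClosed
  have : (kernel T.D : Set H) = (fun v : H => (v, (0 : H))) ⁻¹' (T.D.graph : Set (H × H)) := by
    ext v
    simp only [kernel, Submodule.map_coe, Set.mem_image, SetLike.mem_coe, LinearMap.mem_ker,
      Set.mem_preimage, LinearPMap.mem_graph_iff, Submodule.subtype_apply]
    constructor
    · rintro ⟨w, hw, rfl⟩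
      exact ⟨w, rfl, hw⟩
    · rintro ⟨w, hw, h0⟩
      exact ⟨w, h0, hw⟩
  rw [this]
  exact IsClosed.preimage (by fun_prop) h

instance : CompleteSpace (kernel T.D) := T.isClosed_kernel.completeSpace_coe

/-- `Π`, the orthogonal projection onto the kernel of `D`. -/
def kerProj : H →L[ℂ] H := (kernel T.D).starProjection

/-- The supertrace. -/
def superTrace (S : H →L[ℂ] H) : ℂ := opTrace (T.γ * S)

/-- `A` preserves `H^∞`. -/
def PreservesSmooth : Prop := ∀ a, ∀ v ∈ smooth T.D, T.π a v ∈ smooth T.D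

variable {T}

/-- The action of `A` on `H^∞`. -/
def aOp (hA : T.PreservesSmooth) (a : A) : Module.End ℂ (smooth T.D) :=
  (T.π a : H →ₗ[ℂ] H).restrict (hA a)

/-- `[D, a]` on `H^∞`. -/
def commOp (hA : T.PreservesSmooth) (a : A) : Module.End ℂ (smooth T.D) :=
  dOp T.D * aOp hA a - aOp hA a * dOp T.D

variable (T) in
/-- `ad_Δ(X) = [Δ, X]` on `H^∞`. -/
def adLaplace (X : Module.End ℂ (smooth T.D)) : Module.End ℂ (smooth T.D) :=
  laplaceOp T.D * X - X * laplaceOp T.D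

/-- The algebra `𝒟(A, D)` of generalized differential operators: the smallest algebra of operators
on `H^∞` that contains `A` and `[D, A]` and is closed under `[Δ, ·]`. -/
def diffAlg (hA : T.PreservesSmooth) : NonUnitalSubalgebra ℂ (Module.End ℂ (smooth T.D)) :=
  sInf {S | (∀ a, aOp hA a ∈ S) ∧ (∀ a, commOp hA a ∈ S) ∧ ∀ X ∈ S, T.adLaplace X ∈ S}

/-- `F 0 ⊆ F 1 ⊆ ⋯` is a filtration of the algebra `𝒟(A, D)` by generalized order, for which `Δ`
has order `r`, and which satisfies the commutator and the elliptic estimates. -/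
structure IsOrderFiltration (hA : T.PreservesSmooth) (r : ℕ)
    (F : ℕ → Submodule ℂ (Module.End ℂ (smooth T.D))) : Prop where
  even_r : Even r
  two_le_r : 2 ≤ r
  mono : Monotone F
  exhaust : ∀ X, X ∈ diffAlg hA ↔ ∃ q, X ∈ F q
  mul_mem : ∀ q q' X Y, X ∈ F q → Y ∈ F q' → X * Y ∈ F (q + q')
  a_mem : ∀ a, aOp hA a ∈ F 0
  ad_mem : ∀ q X, X ∈ F q → T.adLaplace X ∈ F (q + r - 1)
  comm_mem : ∀ a, commOp hA a ∈ F (r / 2 - 1)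
  elliptic : ∀ q X, X ∈ F q → ∃ ε : ℝ, 0 < ε ∧ ∀ v : smooth T.D,
    ε * ‖X v‖ ≤ ‖(v : H)‖ + ‖posPow T.D ((q : ℝ) / r) v‖

variable (T) in
/-- For all `X` of order `q` and all `z` with `Re z > (q + n) / r`, the operator `X Δ^{-z}` extends
by continuity to a trace class operator. -/
def TraceClassBeyond (r : ℕ) (F : ℕ → Submodule ℂ (Module.End ℂ (smooth T.D))) (n : ℝ) : Prop :=
  ∀ (q : ℕ), ∀ X ∈ F q, ∀ z : ℂ, (q + n) / r < z.re →
    ∃ S : H →L[ℂ] H, ExtendsComp X (cpowNeg T.D z) S ∧ IsTraceClass S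

variable (T) in
/-- The filtered algebra has finite analytic dimension, equal to `n`. -/
def HasAnalyticDimension (r : ℕ) (F : ℕ → Submodule ℂ (Module.End ℂ (smooth T.D)))
    (n : ℝ) : Prop :=
  IsLeast {m : ℝ | 0 ≤ m ∧ T.TraceClassBeyond r F m} n

variable (T) in
/-- The analytic continuation property: for all `X` of order `q`, the function `Tr(X Δ^{-z})`
on the half-plane `Re z > (q + n) / r` extends to a meromorphic function on `ℂ`. -/
def AnalyticContinuationProperty (r : ℕ) (F : ℕ → Submodule ℂ (Module.End ℂ (smooth T.D)))
    (n : ℝ) : Prop :=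
  ∀ (q : ℕ), ∀ X ∈ F q, ∃ G : ℂ → ℂ, MeromorphicOn G Set.univ ∧
    ∀ z : ℂ, (q + n) / r < z.re → G z = opTrace (extComp X (cpowNeg T.D z))

/-- `P_k(a_0, …, a_p) = a_0 [D, a_1]^{(k_1)} ⋯ [D, a_p]^{(k_p)}`, where `X^{(l)} = ad_Δ^l(X)`. -/
def opP (hA : T.PreservesSmooth) {p : ℕ} (k : Fin p → ℕ) (a : Fin (p + 1) → A) :
    Module.End ℂ (smooth T.D) :=
  aOp hA (a 0) * (List.ofFn fun i : Fin p => T.adLaplace^[k i] (commOp hA (a i.succ))).prod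

variable (T) in
/-- The zeta function `Tr_s(X Δ^{-z})`, for `Re z` large. -/
def superZeta (X : Module.End ℂ (smooth T.D)) (z : ℂ) : ℂ :=
  T.superTrace (extComp X (cpowNeg T.D z))

variable (T) in
/-- The heat supertrace `Tr_s(X e^{-tΔ})`, for `t > 0`. -/
def heatSuperTrace (X : Module.End ℂ (smooth T.D)) (t : ℝ) : ℂ :=
  T.superTrace (extComp X (heat T.D t))

end EvenSpectralTriple

/-! ### The residue cocycle -/

open scoped Classical in
/-- The finite set of multi-indices `k = (k_1, …, k_p)` with `|k| ≤ n - p`. -/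
def multiIndices (p : ℕ) (n : ℝ) : Finset (Fin p → ℕ) :=
  {k ∈ Fintype.piFinset fun _ : Fin p => Finset.range (⌊n⌋₊ + 1) |
    ((∑ i, k i : ℕ) : ℝ) ≤ n - p}

theorem mem_multiIndices {p : ℕ} {n : ℝ} {k : Fin p → ℕ} :
    k ∈ multiIndices p n ↔ ((∑ i, k i : ℕ) : ℝ) ≤ n - p := by
  simp only [multiIndices, Finset.mem_filter, Fintype.mem_piFinset, Finset.mem_range,
    and_iff_right_iff_imp, Nat.lt_succ_iff]
  intro h i
  refine Nat.le_floor (le_trans ?_ (h.trans (sub_le_self _ (Nat.cast_nonneg p))))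
  exact_mod_cast Finset.single_le_sum (f := k) (fun _ _ => Nat.zero_le _) (Finset.mem_univ i)

/-- `c'_{pk} = (-1)^{|k|} / (k! (k_1 + 1) (k_1 + k_2 + 2) ⋯ (k_1 + ⋯ + k_p + p))`. -/
def cPrime {p : ℕ} (k : Fin p → ℕ) : ℂ :=
  (-1) ^ (∑ i, k i) / ((∏ i, ((k i).factorial : ℂ)) *
    ∏ j : Fin p, ((∑ i ∈ Finset.Iic j, k i : ℕ) + (j : ℕ) + 1 : ℂ))

/-- `c_{pk} = (-1)^{|k|} Γ(p/2 + |k|) / (k! (k_1 + 1) (k_1 + k_2 + 2) ⋯ (k_1 + ⋯ + k_p + p))`. -/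
def cConst {p : ℕ} (k : Fin p → ℕ) : ℂ :=
  (-1) ^ (∑ i, k i) / (∏ i, ((k i).factorial : ℂ)) *
    (Complex.Gamma ((p : ℂ) / 2 + (∑ i, k i : ℕ)) /
      ∏ j : Fin p, ((∑ i ∈ Finset.Iic j, k i : ℕ) + (j : ℕ) + 1 : ℂ))

/-- The component `φ_p(a_0, …, a_p)` of the residue cocycle of a spectral triple of analytic
dimension `n`: `φ_0(a_0) = Res_{z=0} (Γ(z) Tr_s(a_0 Δ^{-z})) + Tr_s(a_0 Π)`, and for `p > 0`
`φ_p(a_0, …, a_p) = ∑_{|k| ≤ n - p} c_{pk} Res_{z = p/2 + |k|} Tr_s(P_k(a_0, …, a_p) Δ^{-z})`. -/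
def residueCocycle {A H : Type*} [NonUnitalRing A] [Module ℂ A]
    [NormedAddCommGroup H] [InnerProductSpace ℂ H] [CompleteSpace H]
    {T : EvenSpectralTriple A H} (hA : T.PreservesSmooth) (n : ℝ) :
    (p : ℕ) → (Fin (p + 1) → A) → ℂ
  | 0, a =>
      contResidue (fun z => Complex.Gamma z * T.superZeta (EvenSpectralTriple.aOp hA (a 0)) z) 0 +
        T.superTrace (T.π (a 0) * T.kerProj)
  | p + 1, a =>
      ∑ k ∈ multiIndices (p + 1) n, cConst k *
        contResidue (T.superZeta (EvenSpectralTriple.opP hA k a))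
          (((p + 1 : ℕ) : ℂ) / 2 + (∑ i, k i : ℕ))

/-- The asymptotic expansion `f(t) ∼ t^{-N} ∑_{s ≥ 0} t^s ψ_s` as `t → 0⁺`. -/
def HasSmallTimeExpansion (f : ℝ → ℂ) (N : ℝ) (ψ : ℕ → ℂ) : Prop :=
  ∀ M : ℕ, (fun t : ℝ => f t - ∑ s ∈ Finset.range (M + 1), ((t ^ ((s : ℝ) - N) : ℝ) : ℂ) * ψ s)
    =o[𝓝[>] (0 : ℝ)] fun t : ℝ => t ^ ((M : ℝ) - N)

open scoped Classical in
/-- The coefficient `ψ_s` at a real index `s`, which is `0` unless `s` is one of `0, 1, 2, …`. -/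
def coeffAt (ψ : ℕ → ℂ) (s : ℝ) : ℂ :=
  if s = (⌊s⌋₊ : ℝ) then ψ ⌊s⌋₊ else 0

end ResidueCocycle

end

open Filter Topology Asymptotics

noncomputable section

namespace ResidueCocycle

/-! ### The resolvent `(1 + Δ)⁻¹`, smooth vectors and the spectral gap. -/

section Resolvent

variable {H : Type*} [NormedAddCommGroup H] [InnerProductSpace ℂ H] [CompleteSpace H]
  {D : H →ₗ.[ℂ] H}

/-! The Mellin transform turns the heat supertrace of `X = P_k` into `Γ(z) Tr_s(X Δ^{-z})`, and each
term `ψ_s t^{s-N}` of the small time expansion into a simple pole at `z = N - s` with residue `ψ_s`.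
The residue at `p/2 + |k|` is therefore `ψ_s` with `s = N - p/2 - |k|`. For `p > 0` the factor
`Γ(p/2 + |k|)` in `c_{pk}` cancels the `1/Γ` left by isolating the zeta function. The heat operator
is the identity on `ker D`, where `Δ^{-z}` vanishes, so the constant `Tr_s(X Π)` has to be removed
from the heat trace before the transform. This matters only at `z = 0`, that is for `p = 0`, where
it is compensated by the second term of `φ_0`.

Analytically, everything is reduced to integrals that converge in operator norm. Choose an integer
`σ > 0` for which `X Δ^{-σ}` extends to a trace class operator `S`. Then `X e^{-tΔ}` extends to `S
Δ^σ e^{-tΔ} + X Π`, and `B ↦ Tr_s(S B)` is a norm-bounded functional that can be moved through the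
integral of `t^{z-1} Δ^σ e^{-tΔ}` (`mellin_heatPow`, `exists_clm_opTrace`). The exponential decay
for large `t` comes from the gap that the Fredholm property opens above `0` in the spectrum of `Δ`
(`exists_gap`, `exists_gappedSet`). The passage from expansions to residues is
`contResidue_of_expansion`; the operator and scalar sides meet in
`exists_mellin_eq_gamma_mul_superZeta`. -/

theorem inner_apply_of_selfAdjoint (hD : IsSelfAdjoint D) (u v : D.domain) :
    inner ℂ (D u) (v : H) = inner ℂ (u : H) (D v) := by
  have h := LinearPMap.adjoint_isFormalAdjoint (T := D) hD.dense_domain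
  rw [LinearPMap.isSelfAdjoint_def.1 hD] at h
  exact h u v

/-- The hypothesis puts `(b, -a)` in the graph of the adjoint, which is the graph of `D`. -/
theorem mem_graph_of_orthogonal (hD : IsSelfAdjoint D) {a b : H}
    (h : ∀ u : D.domain, inner ℂ (u : H) a + inner ℂ (D u) b = 0) :
    ∃ hb : b ∈ D.domain, D ⟨b, hb⟩ = -a := by
  have h' : (b, -a) ∈ D.graph.adjoint := by
    rw [Submodule.mem_adjoint_iff]
    intro x y hxy
    obtain ⟨u, rfl, rfl⟩ := (LinearPMap.mem_graph_iff _).1 hxy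
    have := h u
    simp only [inner_neg_right]
    linear_combination this
  rw [← LinearPMap.adjoint_graph_eq_graph_adjoint hD.dense_domain,
    LinearPMap.isSelfAdjoint_def.1 hD, LinearPMap.mem_graph_iff] at h'
  obtain ⟨u, hu, hDu⟩ := h'
  refine ⟨by simpa [hu] using u.2, Eq.trans ?_ hDu⟩
  congr 1
  exact Subtype.ext hu.symm

/-- The orthogonal decomposition of `(v, 0)` along the graph of `D` and its complement solves
`(1 + D²) u = v`. -/
theorem exists_solution (hD : IsSelfAdjoint D) (v : H) :
    ∃ u, ∃ hu : u ∈ (laplace D).domain, u + laplace D ⟨u, hu⟩ = v := by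
  -- The product `H × H` carries the sup norm; orthogonality to the graph needs its `L²` version.
  let e := WithLp.linearEquiv 2 ℂ (H × H)
  let G : Submodule ℂ (WithLp 2 (H × H)) := D.graph.comap e.toLinearMap
  have hG : IsClosed (G : Set (WithLp 2 (H × H))) :=
    IsClosed.preimage (WithLp.prod_continuous_ofLp 2 H H) hD.isClosed
  have : CompleteSpace G := hG.completeSpace_coe
  obtain ⟨g, hg, g', hg', hsum⟩ := G.exists_add_mem_mem_orthogonal (WithLp.toLp 2 (v, (0 : H)))
  obtain ⟨u, hu1, hu2⟩ := (LinearPMap.mem_graph_iff _).1 (show (g.fst, g.snd) ∈ D.graph from hg)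
  have h1 : v = g.fst + g'.fst := congrArg WithLp.fst hsum
  have h2 : (0 : H) = g.snd + g'.snd := congrArg WithLp.snd hsum
  obtain ⟨hb, hDb⟩ := mem_graph_of_orthogonal hD (a := g'.fst) (b := g'.snd) fun w => by
    have := (Submodule.mem_orthogonal _ _).1 hg' (WithLp.toLp 2 ((w : H), D w))
      ((LinearPMap.mem_graph_iff _).2 ⟨w, rfl, rfl⟩)
    simpa [WithLp.prod_inner_apply] using this
  have h3 : g'.snd = -D u := by
    rw [hu2]
    exact eq_neg_of_add_eq_zero_right h2.symm
  have hDu : D u ∈ D.domain := by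
    rw [h3] at hb
    simpa using hb
  refine ⟨u, mem_laplace_domain.2 ⟨u.2, hDu⟩, ?_⟩
  have h4 : laplace D ⟨u, mem_laplace_domain.2 ⟨u.2, hDu⟩⟩ = D ⟨D u, hDu⟩ :=
    compPMap_apply u.2 hDu _
  have h5 : D ⟨D u, hDu⟩ = g'.fst := by
    rw [← neg_neg g'.fst, ← hDb, ← LinearPMap.map_neg]
    congr 1
    apply Subtype.ext
    simp [h3]
  rw [h4, h5, h1, hu1]

theorem inner_laplace (hD : IsSelfAdjoint D) {u v : H} (hu : u ∈ (laplace D).domain)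
    (hv : v ∈ D.domain) :
    inner ℂ v (laplace D ⟨u, hu⟩) =
      inner ℂ (D ⟨v, hv⟩) (D ⟨u, (mem_laplace_domain.1 hu).1⟩) := by
  obtain ⟨h1, h2⟩ := mem_laplace_domain.1 hu
  rw [show laplace D ⟨u, hu⟩ = D ⟨D ⟨u, h1⟩, h2⟩ from compPMap_apply h1 h2 hu]
  exact (inner_apply_of_selfAdjoint hD ⟨v, hv⟩ ⟨D ⟨u, h1⟩, h2⟩).symm

theorem inner_add_laplace_self (hD : IsSelfAdjoint D) {u : H} (hu : u ∈ (laplace D).domain) :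
    inner ℂ u (u + laplace D ⟨u, hu⟩) =
      ((‖u‖ ^ 2 + ‖D ⟨u, (mem_laplace_domain.1 hu).1⟩‖ ^ 2 : ℝ) : ℂ) := by
  rw [inner_add_right, inner_laplace hD hu (mem_laplace_domain.1 hu).1,
    inner_self_eq_norm_sq_to_K, inner_self_eq_norm_sq_to_K]
  simp

/-- Cauchy–Schwarz applied to `⟨u, (1 + Δ)u⟩ = ‖u‖² + ‖Du‖²`. This gives both injectivity of `1 + Δ`
and the bound `1` for its inverse. -/
theorem norm_le_norm_add_laplace (hD : IsSelfAdjoint D) {u : H} (hu : u ∈ (laplace D).domain) :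
    ‖u‖ ≤ ‖u + laplace D ⟨u, hu⟩‖ := by
  have h1 := inner_add_laplace_self hD hu
  have h2 := norm_inner_le_norm (𝕜 := ℂ) u (u + laplace D ⟨u, hu⟩)
  rw [h1, Complex.norm_real, Real.norm_of_nonneg (by positivity)] at h2
  rcases (norm_nonneg u).eq_or_lt with h0 | h0
  · rw [← h0]; exact norm_nonneg _
  · nlinarith [sq_nonneg ‖D ⟨u, (mem_laplace_domain.1 hu).1⟩‖]

theorem exists_resolvent (hD : IsSelfAdjoint D) : ∃ R : H →L[ℂ] H,
    (∀ v, ∃ hv : R v ∈ (laplace D).domain, R v + laplace D ⟨R v, hv⟩ = v) ∧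
    (∀ u : (laplace D).domain, R (u + laplace D u) = u) := by
  let f : (laplace D).domain →ₗ[ℂ] H := (laplace D).domain.subtype + (laplace D).toFun
  have hf : ∀ u : (laplace D).domain, f u = u + laplace D u := fun u => rfl
  have hinj : Function.Injective f := by
    rw [injective_iff_map_eq_zero]
    intro u hu
    have := norm_le_norm_add_laplace hD u.2
    rw [← hf, hu, norm_zero] at this
    exact Subtype.ext (norm_le_zero_iff.1 this)
  have hsurj : Function.Surjective f := fun v => by
    obtain ⟨u, hu, h⟩ := exists_solution hD v
    exact ⟨⟨u, hu⟩, h⟩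
  let E := LinearEquiv.ofBijective f ⟨hinj, hsurj⟩
  have hE : ∀ v, ((E.symm v : (laplace D).domain) : H) + laplace D (E.symm v) = v := fun v =>
    E.apply_symm_apply v
  refine ⟨LinearMap.mkContinuous ((laplace D).domain.subtype ∘ₗ E.symm.toLinearMap) 1 fun v => ?_,
    fun v => ⟨(E.symm v).2, hE v⟩, fun u => congrArg Subtype.val (E.symm_apply_apply u)⟩
  have := norm_le_norm_add_laplace hD (E.symm v).2
  rw [one_mul]
  exact this.trans_eq (congrArg norm (hE v))

theorem resolvent_spec (hD : IsSelfAdjoint D) (v : H) :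
    ∃ hv : invOneAddSq D v ∈ (laplace D).domain,
      invOneAddSq D v + laplace D ⟨invOneAddSq D v, hv⟩ = v := by
  have h := exists_resolvent hD
  rw [invOneAddSq, dif_pos h]
  exact h.choose_spec.1 v

theorem resolvent_apply_add (hD : IsSelfAdjoint D) (u : (laplace D).domain) :
    invOneAddSq D (u + laplace D u) = u := by
  have h := exists_resolvent hD
  rw [invOneAddSq, dif_pos h]
  exact h.choose_spec.2 u

theorem resolvent_mem (hD : IsSelfAdjoint D) (v : H) : invOneAddSq D v ∈ (laplace D).domain :=
  (resolvent_spec hD v).1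

theorem laplace_resolvent (hD : IsSelfAdjoint D) (v : H)
    (hv : invOneAddSq D v ∈ (laplace D).domain) :
    laplace D ⟨invOneAddSq D v, hv⟩ = v - invOneAddSq D v :=
  eq_sub_of_add_eq' (resolvent_spec hD v).2

theorem resolvent_injective (hD : IsSelfAdjoint D) {v : H} (hv : invOneAddSq D v = 0) : v = 0 := by
  obtain ⟨h, hs⟩ := resolvent_spec hD v
  have : (⟨invOneAddSq D v, h⟩ : (laplace D).domain) = 0 := Subtype.ext hv
  rw [this, LinearPMap.map_zero, hv, add_zero] at hs
  exact hs.symm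

/-- The right side is a Hermitian, non-negative form in `v` and `w`, so self-adjointness and
positivity of the resolvent can both be read off. -/
theorem inner_resolvent_right (hD : IsSelfAdjoint D) (v w : H) :
    inner ℂ v (invOneAddSq D w) = inner ℂ (invOneAddSq D v) (invOneAddSq D w) +
      inner ℂ (D ⟨invOneAddSq D v, (mem_laplace_domain.1 (resolvent_mem hD v)).1⟩)
        (D ⟨invOneAddSq D w, (mem_laplace_domain.1 (resolvent_mem hD w)).1⟩) := by
  obtain ⟨hv, hs⟩ := resolvent_spec hD v
  have hw := (mem_laplace_domain.1 (resolvent_mem hD w)).1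
  conv_lhs => rw [← hs, inner_add_left, ← inner_conj_symm (laplace D _), inner_laplace hD hv hw,
    inner_conj_symm]

theorem resolvent_selfAdjoint (hD : IsSelfAdjoint D) : IsSelfAdjoint (invOneAddSq D) := by
  rw [ContinuousLinearMap.isSelfAdjoint_iff_isSymmetric]
  intro v w
  change inner ℂ (invOneAddSq D v) w = inner ℂ v (invOneAddSq D w)
  rw [inner_resolvent_right hD v w, ← inner_conj_symm, inner_resolvent_right hD w v, map_add,
    inner_conj_symm, inner_conj_symm]

theorem resolvent_nonneg (hD : IsSelfAdjoint D) : 0 ≤ invOneAddSq D := by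
  rw [ContinuousLinearMap.nonneg_iff_isPositive]
  refine ⟨(ContinuousLinearMap.isSelfAdjoint_iff_isSymmetric.1 (resolvent_selfAdjoint hD)),
    fun v => ?_⟩
  rw [ContinuousLinearMap.reApplyInnerSelf, inner_re_symm, inner_resolvent_right hD v v, map_add]
  exact add_nonneg inner_self_nonneg inner_self_nonneg

theorem denseRange_resolvent (hD : IsSelfAdjoint D) : DenseRange (invOneAddSq D) := by
  have h : ((invOneAddSq D).range)ᗮ = ⊥ := by
    rw [ContinuousLinearMap.orthogonal_range, (resolvent_selfAdjoint hD).adjoint_eq]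
    exact (LinearMap.ker_eq_bot').2 fun v hv => resolvent_injective hD hv
  have := Submodule.dense_iff_topologicalClosure_eq_top.2
    ((Submodule.topologicalClosure_eq_top_iff).2 h)
  simpa using! this

omit [CompleteSpace H] in
theorem mem_kernel {v : H} : v ∈ kernel D ↔ ∃ hv : v ∈ D.domain, D ⟨v, hv⟩ = 0 := by
  constructor
  · rintro ⟨w, hw, rfl⟩
    exact ⟨w.2, hw⟩
  · rintro ⟨hv, h⟩
    exact ⟨⟨v, hv⟩, h, rfl⟩

/-- `ker D = ker Δ` because `⟨v, Δv⟩ = ‖Dv‖²`, and `ker Δ` is the eigenspace of the resolvent for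
the eigenvalue `1`. -/
theorem mem_kernel_iff_resolvent (hD : IsSelfAdjoint D) {v : H} :
    v ∈ kernel D ↔ invOneAddSq D v = v := by
  rw [mem_kernel]
  constructor
  · rintro ⟨hv, h⟩
    have h2 : D ⟨v, hv⟩ ∈ D.domain := by rw [h]; exact zero_mem _
    have hl : v ∈ (laplace D).domain := mem_laplace_domain.2 ⟨hv, h2⟩
    have h3 : laplace D ⟨v, hl⟩ = 0 := by
      rw [show laplace D ⟨v, hl⟩ = D ⟨D ⟨v, hv⟩, h2⟩ from compPMap_apply hv h2 hl,
        ← D.map_zero]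
      congr 1
      exact Subtype.ext h
    have := resolvent_apply_add hD ⟨v, hl⟩
    rwa [h3, add_zero] at this
  · intro h
    have hl : v ∈ (laplace D).domain := h ▸ resolvent_mem hD v
    refine ⟨(mem_laplace_domain.1 hl).1, ?_⟩
    have h1 := resolvent_apply_add hD ⟨v, hl⟩
    have h0 : laplace D ⟨v, hl⟩ = 0 := by
      rw [map_add, h, add_eq_left] at h1
      exact resolvent_injective hD h1
    have h2 := inner_laplace hD hl (mem_laplace_domain.1 hl).1
    rw [h0, inner_zero_right] at h2
    exact inner_self_eq_zero.1 h2.symm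

theorem mem_laplace_domain_iff_range (hD : IsSelfAdjoint D) {v : H} :
    v ∈ (laplace D).domain ↔ ∃ w, invOneAddSq D w = v :=
  ⟨fun h => ⟨_, resolvent_apply_add hD ⟨v, h⟩⟩, by rintro ⟨w, rfl⟩; exact resolvent_mem hD w⟩

theorem mem_pow_domain_iff (hD : IsSelfAdjoint D) (s : ℕ) {v : H} :
    v ∈ (powPMap (laplace D) s).domain ↔ ∃ w, (invOneAddSq D ^ s) w = v := by
  induction s generalizing v with
  | zero => exact ⟨fun _ => ⟨v, rfl⟩, fun _ => Submodule.mem_top⟩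
  | succ s ih =>
    change v ∈ (compPMap (powPMap (laplace D) s) (laplace D)).domain ↔ _
    rw [mem_compPMap_domain]
    constructor
    · rintro ⟨hv, h⟩
      obtain ⟨u, rfl⟩ := (mem_laplace_domain_iff_range hD).1 hv
      rw [laplace_resolvent hD, ih] at h
      -- Bootstrap with `R = (1 + Δ)⁻¹`: if `u` lies in the range of `R ^ j`, then `u = (u - R u) +
      -- R u` lies in the range of `R ^ (j + 1)`, as long as `j + 1 ≤ s`.
      suffices h' : ∀ j ≤ s, ∃ w, (invOneAddSq D ^ j) w = u by
        obtain ⟨w, rfl⟩ := h' s le_rfl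
        exact ⟨w, by rw [pow_succ']; rfl⟩
      intro j
      induction j with
      | zero => exact fun _ => ⟨u, rfl⟩
      | succ j ihj =>
        intro hj
        obtain ⟨w, hw⟩ := ihj (by omega)
        obtain ⟨w', hw'⟩ := h
        refine ⟨(invOneAddSq D ^ (s - (j + 1))) w' + w, ?_⟩
        rw [map_add, ← mul_apply_eq_comp, ← pow_add, Nat.add_sub_cancel' hj, hw',
          pow_succ', mul_apply_eq_comp, hw, sub_add_cancel]
    · rintro ⟨w, rfl⟩
      rw [pow_succ', mul_apply_eq_comp]
      refine ⟨resolvent_mem hD _, ?_⟩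
      rw [laplace_resolvent hD]
      refine Submodule.sub_mem _ (ih.2 ⟨w, rfl⟩) (ih.2 ⟨invOneAddSq D w, ?_⟩)
      rw [← mul_apply_eq_comp, ← mul_apply_eq_comp, ← pow_succ, ← pow_succ']

theorem mem_smooth_iff (hD : IsSelfAdjoint D) {v : H} :
    v ∈ smooth D ↔ ∀ s : ℕ, ∃ w, (invOneAddSq D ^ (s + 1)) w = v := by
  rw [smooth, Submodule.mem_iInf]
  exact forall_congr' fun s => mem_pow_domain_iff hD (s + 1)

theorem mem_smooth_of_commute (hD : IsSelfAdjoint D) {B : H →L[ℂ] H}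
    (hB : Commute B (invOneAddSq D)) {v : H} (hv : v ∈ smooth D) : B v ∈ smooth D := by
  rw [mem_smooth_iff hD] at hv ⊢
  intro s
  obtain ⟨w, rfl⟩ := hv s
  exact ⟨B w, congrArg (fun C : H →L[ℂ] H => C w) (hB.pow_right (s + 1)).eq.symm⟩

theorem kernel_le_smooth (hD : IsSelfAdjoint D) : kernel D ≤ smooth D := fun v hv => by
  rw [mem_kernel_iff_resolvent hD] at hv
  refine (mem_smooth_iff hD).2 fun s => ⟨v, ?_⟩
  induction s + 1 with
  | zero => rfl
  | succ j ih => rw [pow_succ, mul_apply_eq_comp, hv, ih]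

/-- The open mapping theorem, applied to the projection of the graph onto the closed range, gives a
preimage `u` of `D v` with `‖u‖ ≤ C ‖D v‖`. Since `u - v` is in the kernel and `v` is orthogonal to
it, `v` is no longer than `u`. -/
theorem exists_gap (hD : IsSelfAdjoint D) (hF : IsFredholm D) :
    ∃ c : ℝ, 0 < c ∧ ∀ v : D.domain, (v : H) ∈ (kernel D)ᗮ → c * ‖(v : H)‖ ≤ ‖D v‖ := by
  have : CompleteSpace D.graph := (show IsClosed (D.graph : Set (H × H)) from
    hD.isClosed).completeSpace_coe
  have : CompleteSpace (LinearMap.range D.toFun) := hF.2.1.completeSpace_coe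
  have hmem : ∀ g : D.graph, (g : H × H).2 ∈ LinearMap.range D.toFun := fun g => by
    obtain ⟨u, -, hu⟩ := (LinearPMap.mem_graph_iff _).1 g.2
    exact ⟨u, hu⟩
  let f : D.graph →L[ℂ] LinearMap.range D.toFun :=
    ((ContinuousLinearMap.snd ℂ H H).comp D.graph.subtypeL).codRestrict _ hmem
  have hf : Function.Surjective f := by
    rintro ⟨_, u, rfl⟩
    exact ⟨⟨(u, D u), (LinearPMap.mem_graph_iff _).2 ⟨u, rfl, rfl⟩⟩, rfl⟩
  obtain ⟨C, hC, h⟩ := f.exists_preimage_norm_le hf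
  refine ⟨C⁻¹, inv_pos.2 hC, fun v hv => ?_⟩
  obtain ⟨g, hg, hle⟩ := h ⟨D v, v, rfl⟩
  obtain ⟨u, hu1, hu2⟩ := (LinearPMap.mem_graph_iff _).1 g.2
  have hDg : (g : H × H).2 = D v := congrArg Subtype.val hg
  have hk : (u : H) - v ∈ kernel D := by
    refine mem_kernel.2 ⟨(u - v).2, ?_⟩
    change D (u - v) = 0
    rw [LinearPMap.map_sub, hu2, hDg, sub_self]
  have h0 : inner ℂ ((u : H) - v) (v : H) = 0 := hv _ hk
  have hvu : ‖(v : H)‖ ≤ ‖(u : H)‖ := by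
    have h2 : ‖(u : H)‖ ^ 2 = ‖(u : H) - v‖ ^ 2 + ‖(v : H)‖ ^ 2 := by
      have := norm_add_sq_eq_norm_sq_add_norm_sq_of_inner_eq_zero ((u : H) - v) (v : H) h0
      rw [sub_add_cancel] at this
      nlinarith
    nlinarith [sq_nonneg ‖(u : H) - v‖, norm_nonneg (u : H), norm_nonneg (v : H)]
  have hug : ‖(u : H)‖ ≤ C * ‖D v‖ := by
    rw [hu1]
    exact (norm_fst_le (g : H × H)).trans hle
  rw [inv_mul_le_iff₀ hC]
  exact hvu.trans hug

theorem resolvent_mem_orthogonal (hD : IsSelfAdjoint D) {v : H} (hv : v ∈ (kernel D)ᗮ) :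
    invOneAddSq D v ∈ (kernel D)ᗮ := fun w hw => by
  have h := (ContinuousLinearMap.isSelfAdjoint_iff_isSymmetric.1 (resolvent_selfAdjoint hD)) w v
  change inner ℂ (invOneAddSq D w) v = inner ℂ w (invOneAddSq D v) at h
  rw [← h, (mem_kernel_iff_resolvent hD).1 hw]
  exact hv w hw

theorem exists_resolvent_norm_le (hD : IsSelfAdjoint D) (hF : IsFredholm D) :
    ∃ θ : ℝ, 0 < θ ∧ θ < 1 ∧ ∀ v ∈ (kernel D)ᗮ, ‖invOneAddSq D v‖ ≤ θ * ‖v‖ := by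
  obtain ⟨c, hc, h⟩ := exists_gap hD hF
  -- With `R = (1 + Δ)⁻¹`, the constant comes from `‖R v‖ ‖v‖ ≥ ⟨R v, v⟩ = ‖R v‖² + ‖D R v‖² ≥ (1 +
  -- c²) ‖R v‖²`.
  refine ⟨(1 + c ^ 2)⁻¹, by positivity, inv_lt_one_of_one_lt₀ (by nlinarith), fun v hv => ?_⟩
  obtain ⟨hm, hs⟩ := resolvent_spec hD v
  have h1 := inner_add_laplace_self hD hm
  have h2 := norm_inner_le_norm (𝕜 := ℂ) (invOneAddSq D v) v
  rw [hs] at h1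
  rw [h1, Complex.norm_real, Real.norm_of_nonneg (by positivity)] at h2
  have h3 := h ⟨_, (mem_laplace_domain.1 hm).1⟩ (resolvent_mem_orthogonal hD hv)
  have h3' := pow_le_pow_left₀ (by positivity) h3 2
  simp only [mul_pow] at h3'
  rw [le_inv_mul_iff₀ (by positivity)]
  rcases (norm_nonneg (invOneAddSq D v)).eq_or_lt with h0 | h0
  · rw [← h0, mul_zero]; exact norm_nonneg _
  · refine le_of_mul_le_mul_left ?_ h0
    nlinarith

end Resolvent

open Set

/-! ### Functions of `μ` transported to the spectral parameter `x = (1 + μ)⁻¹`. -/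

section Calculus

/-- The function of the spectral parameter `x = (1 + μ)⁻¹` that corresponds to a function of `μ`. -/
def calcFun (f : ℝ → ℂ) (x : ℂ) : ℂ := if x = 0 then 0 else f (x.re⁻¹ - 1)

/-- The spectral parameters of a non-negative operator `Δ` that has no spectrum in `(0, θ⁻¹ - 1)`. -/
def GappedSet (θ : ℝ) (K : Set ℂ) : Prop :=
  ∀ x ∈ K, 0 ≤ x.re ∧ x = x.re ∧ (x = 1 ∨ x.re ≤ θ)

theorem GappedSet.re_pos {θ : ℝ} {K : Set ℂ} (hK : GappedSet θ K) {x : ℂ} (hx : x ∈ K)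
    (h0 : x ≠ 0) : 0 < x.re := by
  obtain ⟨h1, h2, -⟩ := hK x hx
  refine h1.lt_of_ne fun h => h0 ?_
  rw [h2, ← h, Complex.ofReal_zero]

theorem GappedSet.cases {θ : ℝ} (hθ : θ < 1) {K : Set ℂ} (hK : GappedSet θ K) {x : ℂ}
    (hx : x ∈ K) : x = 0 ∨ x = 1 ∨ (0 < x.re ∧ x.re ≤ θ ∧ θ⁻¹ - 1 ≤ x.re⁻¹ - 1 ∧
      0 < x.re⁻¹ - 1) := by
  by_cases h0 : x = 0
  · exact Or.inl h0
  · have hp := hK.re_pos hx h0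
    refine Or.inr ((hK x hx).2.2.imp_right fun h => ⟨hp, h, ?_, ?_⟩)
    · exact sub_le_sub_right (inv_anti₀ hp h) 1
    · exact sub_pos.2 ((one_lt_inv₀ hp).2 (h.trans_lt hθ))

/-- Three regimes: at `x = 0` (`μ = ∞`) decay locally uniform in `t` is needed; `x = 1` (`μ = 0`) is
isolated in `K` by the gap, so `f t` may jump at `0`; elsewhere `x ↦ x⁻¹ - 1` is continuous with
positive values. -/
theorem continuousOn_calcFun_param {X : Type*} [TopologicalSpace X] {s : Set X} {f : X → ℝ → ℂ}
    {θ : ℝ} (hθ : θ < 1) {K : Set ℂ} (hK : GappedSet θ K)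
    (hf : ContinuousOn (Function.uncurry f) (s ×ˢ Ioi 0)) (h0 : ContinuousOn (fun t => f t 0) s)
    (hinf : ∀ t ∈ s, Tendsto (Function.uncurry f) (𝓝[s] t ×ˢ atTop) (𝓝 0)) :
    ContinuousOn (Function.uncurry fun t => calcFun (f t)) (s ×ˢ K) := by
  rintro ⟨t, x⟩ ⟨ht, hx⟩
  rcases hK.cases hθ hx with rfl | rfl | ⟨hp, hle, -, hpos⟩
  · have hsub : s ×ˢ K ⊆ s ×ˢ {0} ∪ s ×ˢ (K \ {0}) := by
      rintro ⟨t', x'⟩ ⟨h1, h2⟩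
      by_cases h : x' = 0
      · exact Or.inl ⟨h1, h⟩
      · exact Or.inr ⟨h1, h2, h⟩
    refine ContinuousWithinAt.mono (ContinuousWithinAt.union ?_ ?_) hsub
    · refine (continuousWithinAt_const : ContinuousWithinAt (fun _ => (0 : ℂ)) _ _).congr ?_ ?_
      · rintro ⟨t', x'⟩ ⟨-, rfl⟩
        simp [calcFun]
      · simp [calcFun]
    · have hval : (Function.uncurry fun t => calcFun (f t)) (t, 0) = 0 := by simp [calcFun]
      rw [ContinuousWithinAt, hval]
      have hg : Tendsto (fun p : X × ℂ => (p.1, p.2.re⁻¹ - 1)) (𝓝[s ×ˢ (K \ {0})] (t, 0))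
          (𝓝[s] t ×ˢ atTop) := by
        rw [nhdsWithin_prod_eq]
        refine Tendsto.prodMap (f := id) (g := fun x : ℂ => x.re⁻¹ - 1) tendsto_id ?_
        refine tendsto_atTop_add_const_right _ _ (tendsto_inv_nhdsGT_zero.comp ?_)
        refine tendsto_nhdsWithin_iff.2 ⟨?_, ?_⟩
        · exact (Complex.continuous_re.tendsto' 0 0 Complex.zero_re).mono_left nhdsWithin_le_nhds
        · filter_upwards [self_mem_nhdsWithin] with x' hx'
          exact hK.re_pos hx'.1 hx'.2
      refine ((hinf t ht).comp hg).congr' ?_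
      filter_upwards [self_mem_nhdsWithin] with p hp
      have : p.2 ≠ 0 := hp.2.2
      simp [calcFun, Function.uncurry, this]
  · have h1 : ContinuousWithinAt (fun p : X × ℂ => f p.1 0) (s ×ˢ K) (t, 1) :=
      ContinuousWithinAt.comp (f := (Prod.fst : X × ℂ → X)) (x := (t, (1 : ℂ))) (h0 t ht)
        continuous_fst.continuousWithinAt fun _ hp => hp.1
    refine h1.congr_of_eventuallyEq ?_ (by simp [calcFun])
    have hopen : {p : X × ℂ | θ < p.2.re} ∈ 𝓝 (t, (1 : ℂ)) :=
      (isOpen_lt continuous_const (by fun_prop)).mem_nhds (by simpa using hθ)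
    filter_upwards [mem_nhdsWithin_of_mem_nhds hopen, self_mem_nhdsWithin] with p hp1 hp2
    have : p.2 = 1 := (hK _ hp2.2).2.2.resolve_right (not_le.2 hp1)
    simp [calcFun, Function.uncurry, this]
  · have hcont : ContinuousWithinAt (fun p : X × ℂ => Function.uncurry f (p.1, p.2.re⁻¹ - 1))
        (s ×ˢ (K ∩ {x | 0 < x.re ∧ x.re < 1})) (t, x) := by
      refine ContinuousWithinAt.comp (x := (t, x)) (f := fun p : X × ℂ => (p.1, p.2.re⁻¹ - 1))
        (hf (t, x.re⁻¹ - 1) ⟨ht, hpos⟩) ?_ ?_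
      · refine continuousWithinAt_fst.prodMk (ContinuousWithinAt.sub ?_ continuousWithinAt_const)
        refine ContinuousWithinAt.inv₀ ?_ hp.ne'
        exact (Complex.continuous_re.comp continuous_snd).continuousWithinAt
      · rintro p ⟨h1, -, h2, h3⟩
        exact ⟨h1, sub_pos.2 ((one_lt_inv₀ h2).2 h3)⟩
    have hopen : {p : X × ℂ | 0 < p.2.re ∧ p.2.re < 1} ∈ 𝓝 (t, x) :=
      ((isOpen_lt continuous_const (Complex.continuous_re.comp continuous_snd)).inter
        (isOpen_lt (Complex.continuous_re.comp continuous_snd) continuous_const)).mem_nhds ⟨hp, hle.trans_lt hθ⟩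
    have hcont' : ContinuousWithinAt (fun p : X × ℂ => Function.uncurry f (p.1, p.2.re⁻¹ - 1))
        (s ×ˢ K) (t, x) := by
      rw [← continuousWithinAt_inter hopen]
      refine hcont.mono ?_
      rintro p ⟨⟨h1, h2⟩, h3⟩
      exact ⟨h1, h2, h3⟩
    have hx0 : x ≠ 0 := fun h => by simp [h] at hp
    refine hcont'.congr_of_eventuallyEq ?_ (by simp [calcFun, hx0])
    filter_upwards [mem_nhdsWithin_of_mem_nhds hopen] with p hp1
    have : p.2 ≠ 0 := fun h => by simp [h] at hp1
    simp [calcFun, Function.uncurry, this]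

/-- Continuous on `(0, ∞)` and vanishing at infinity. -/
def Admissible (f : ℝ → ℂ) : Prop := ContinuousOn f (Ioi 0) ∧ Tendsto f atTop (𝓝 0)

theorem Admissible.continuousOn_calcFun {f : ℝ → ℂ} (hf : Admissible f)
    {θ : ℝ} (hθ : θ < 1) {K : Set ℂ} (hK : GappedSet θ K) : ContinuousOn (calcFun f) K := by
  have := continuousOn_calcFun_param (X := Unit) (s := univ) (f := fun _ => f) hθ hK
    (hf.1.comp continuousOn_snd fun p hp => hp.2) continuousOn_const
    fun t _ => hf.2.comp tendsto_snd
  exact this.comp (f := fun x => ((), x)) (by fun_prop) fun x hx => ⟨mem_univ _, hx⟩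

theorem Admissible.mul {f g : ℝ → ℂ} (hf : Admissible f) (hg : Admissible g) :
    Admissible fun μ => f μ * g μ :=
  ⟨hf.1.mul hg.1, by simpa using hf.2.mul hg.2⟩

theorem Admissible.sub {f g : ℝ → ℂ} (hf : Admissible f) (hg : Admissible g) :
    Admissible fun μ => f μ - g μ :=
  ⟨hf.1.sub hg.1, by simpa using hf.2.sub hg.2⟩

theorem Admissible.congr {f g : ℝ → ℂ} (hf : Admissible f) (h : ∀ μ, 0 < μ → f μ = g μ) :
    Admissible g :=
  ⟨hf.1.congr fun μ hμ => (h μ hμ).symm,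
    hf.2.congr' ((eventually_gt_atTop 0).mono fun μ hμ => h μ hμ)⟩

theorem admissible_inv : Admissible fun μ : ℝ => ((1 + μ : ℝ) : ℂ)⁻¹ := by
  constructor
  · intro μ hμ
    have : (1 + μ) ≠ 0 := by have : 0 < μ := hμ; positivity
    refine ContinuousAt.continuousWithinAt (ContinuousAt.inv₀ (by fun_prop) ?_)
    exact_mod_cast this
  · have h : Tendsto (fun μ : ℝ => (1 + μ)⁻¹) atTop (𝓝 0) :=
      tendsto_inv_atTop_zero.comp (tendsto_atTop_add_const_left _ _ tendsto_id)
    have := (Complex.continuous_ofReal.tendsto' 0 0 Complex.ofReal_zero).comp h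
    exact this.congr fun μ => by simp

theorem admissible_pow_mul_exp (P : Polynomial ℝ) {t : ℝ} (ht : 0 < t) :
    Admissible fun μ : ℝ => ((P.eval μ * Real.exp (-(t * μ)) : ℝ) : ℂ) := by
  refine ⟨by fun_prop, ?_⟩
  refine (Complex.continuous_ofReal.tendsto' 0 0 Complex.ofReal_zero).comp ?_
  have h := Polynomial.isEquivalent_atTop_lead P
  have h2 : P.eval =O[atTop] fun μ : ℝ => μ ^ P.natDegree :=
    h.isBigO.trans (isBigO_const_mul_self _ _ _)
  have h3 := h2.trans_isLittleO (isLittleO_pow_exp_pos_mul_atTop P.natDegree ht)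
  refine (h3.tendsto_div_nhds_zero).congr fun μ => ?_
  rw [Real.exp_neg, div_eq_mul_inv]

theorem admissible_cpow {z : ℂ} (hz : 0 < z.re) :
    Admissible fun μ : ℝ => if μ = 0 then 0 else (μ : ℂ) ^ (-z) := by
  have h : Admissible fun μ : ℝ => (μ : ℂ) ^ (-z) := by
    constructor
    · intro μ hμ
      exact (Complex.continuousAt_ofReal_cpow_const _ _ (Or.inr (ne_of_gt hμ))).continuousWithinAt
    · rw [tendsto_zero_iff_norm_tendsto_zero]
      refine (tendsto_rpow_neg_atTop hz).congr' ?_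
      filter_upwards [eventually_gt_atTop 0] with μ hμ
      rw [Complex.norm_cpow_eq_rpow_re_of_pos hμ, Complex.neg_re]
  exact h.congr fun μ hμ => by rw [if_neg hμ.ne']

theorem admissible_indicator : Admissible fun μ : ℝ => if μ = 0 then 1 else 0 := by
  have h : Admissible fun _ : ℝ => (0 : ℂ) := ⟨continuousOn_const, tendsto_const_nhds⟩
  exact h.congr fun μ hμ => by rw [if_neg hμ.ne']

end Calculus

/-! ### The functional calculus of `Δ`. -/

section Laplace

variable {H : Type*} [NormedAddCommGroup H] [InnerProductSpace ℂ H] [CompleteSpace H]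
  {D : H →ₗ.[ℂ] H}

theorem laplaceCalc_eq (f : ℝ → ℂ) : laplaceCalc D f = cfc (calcFun f) (invOneAddSq D) := by
  unfold laplaceCalc calcFun
  congr!

theorem resolvent_normal (hD : IsSelfAdjoint D) : IsStarNormal (invOneAddSq D) :=
  (resolvent_selfAdjoint hD).isStarNormal

omit [CompleteSpace H] in
theorem norm_resolvent_mul_compl_le [(kernel D).HasOrthogonalProjection] {θ : ℝ} (hθ : 0 ≤ θ)
    (h : ∀ v ∈ (kernel D)ᗮ, ‖invOneAddSq D v‖ ≤ θ * ‖v‖) :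
    ‖invOneAddSq D * (1 - (kernel D).starProjection)‖ ≤ θ := by
  refine ContinuousLinearMap.opNorm_le_bound _ hθ fun v => ?_
  have h1 : (1 - (kernel D).starProjection) v = (kernel D)ᗮ.starProjection v := by
    rw [Submodule.starProjection_orthogonal']
  rw [mul_apply_eq_comp, h1]
  refine (h _ (Submodule.starProjection_apply_mem _ _)).trans ?_
  gcongr
  exact Submodule.norm_starProjection_apply_le _ _

/-- On `ker D` the resolvent is `1`, and on the orthogonal complement its norm is at most `θ < 1`.
-/
theorem exists_gappedSet (hD : IsSelfAdjoint D) (hF : IsFredholm D) :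
    ∃ θ : ℝ, 0 < θ ∧ θ < 1 ∧ GappedSet θ (spectrum ℂ (invOneAddSq D)) := by
  obtain ⟨θ, h0, h1, hθ⟩ := exists_resolvent_norm_le hD hF
  have : FiniteDimensional ℂ (kernel D) := hF.1
  refine ⟨θ, h0, h1, fun x hx => ⟨?_, (resolvent_selfAdjoint hD).mem_spectrum_eq_re hx, ?_⟩⟩
  · have hr := (resolvent_selfAdjoint hD).spectrumRestricts.algebraMap_image
    rw [← hr] at hx
    obtain ⟨y, hy, rfl⟩ := hx
    exact spectrum_nonneg_of_nonneg (resolvent_nonneg hD) hy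
  · by_contra hcon
    push Not at hcon
    obtain ⟨hx1, hxθ⟩ := hcon
    rcases subsingleton_or_nontrivial H with hs | hn
    · rw [spectrum.of_subsingleton] at hx
      exact hx
    set R := invOneAddSq D with hR
    set P := (kernel D).starProjection with hP
    have hx0 : x ≠ 0 := fun h => by simp [h] at hxθ; linarith
    have hnorm : θ < ‖x‖ := hxθ.trans_le (Complex.re_le_norm x)
    have hRP : R * P = P := by
      ext v
      exact (mem_kernel_iff_resolvent hD).1 (Submodule.starProjection_apply_mem _ _)
    have hPR : P * R = P := by
      have h := congrArg star hRP
      rwa [star_mul, (resolvent_selfAdjoint hD).star_eq,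
        (isSelfAdjoint_starProjection (kernel D)).star_eq] at h
    have hPP : P * P = P := (kernel D).isIdempotentElem_starProjection
    have hu1 : IsUnit (algebraMap ℂ (H →L[ℂ] H) x - R * (1 - P)) :=
      spectrum.mem_resolventSet_iff.1 (spectrum.mem_resolventSet_of_norm_lt
        ((norm_resolvent_mul_compl_le h0.le hθ).trans_lt hnorm))
    have hu2 : IsUnit (algebraMap ℂ (H →L[ℂ] H) x - P) := by
      by_contra hcon
      rcases IsIdempotentElem.spectrum_subset ℂ (p := P) hPP (spectrum.mem_iff.2 hcon) with h | h
      · exact hx0 h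
      · exact hx1 h
    refine spectrum.mem_iff.1 hx ?_
    -- Since `R P = P`, the factors separate the two spectral parts: the first is invertible as `|x|
    -- > θ`, the second as `x` is neither `0` nor `1`.
    have hprod : (algebraMap ℂ (H →L[ℂ] H) x - R * (1 - P)) *
        (algebraMap ℂ (H →L[ℂ] H) x - P) =
          algebraMap ℂ (H →L[ℂ] H) x * (algebraMap ℂ (H →L[ℂ] H) x - R) := by
      have hc := Algebra.commutes x R
      have hc' := Algebra.commutes x P
      simp only [mul_sub, sub_mul, mul_one, hRP, hPP, hc, hc']
      abel
    have hux : IsUnit (algebraMap ℂ (H →L[ℂ] H) x) := (IsUnit.mk0 x hx0).map _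
    have := hu1.mul hu2
    rw [hprod] at this
    exact (hux.mul_left_iff).1 this

theorem calc_mul (hD : IsSelfAdjoint D) (hF : IsFredholm D) {f g : ℝ → ℂ} (hf : Admissible f)
    (hg : Admissible g) :
    laplaceCalc D (fun μ => f μ * g μ) = laplaceCalc D f * laplaceCalc D g := by
  obtain ⟨θ, -, h1, hK⟩ := exists_gappedSet hD hF
  have hR := resolvent_normal hD
  rw [laplaceCalc_eq, laplaceCalc_eq, laplaceCalc_eq,
    ← cfc_mul _ _ _ (hf.continuousOn_calcFun h1 hK) (hg.continuousOn_calcFun h1 hK)]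
  congr 1
  ext x
  unfold calcFun
  split_ifs <;> simp

theorem calc_sub (hD : IsSelfAdjoint D) (hF : IsFredholm D) {f g : ℝ → ℂ} (hf : Admissible f)
    (hg : Admissible g) :
    laplaceCalc D (fun μ => f μ - g μ) = laplaceCalc D f - laplaceCalc D g := by
  obtain ⟨θ, -, h1, hK⟩ := exists_gappedSet hD hF
  have hR := resolvent_normal hD
  rw [laplaceCalc_eq, laplaceCalc_eq, laplaceCalc_eq,
    ← cfc_sub _ _ _ (hf.continuousOn_calcFun h1 hK) (hg.continuousOn_calcFun h1 hK)]
  congr 1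
  ext x
  unfold calcFun
  split_ifs <;> simp

theorem calc_congr (hD : IsSelfAdjoint D) (hF : IsFredholm D) {f g : ℝ → ℂ}
    (h : ∀ μ, 0 ≤ μ → f μ = g μ) : laplaceCalc D f = laplaceCalc D g := by
  obtain ⟨θ, -, h1, hK⟩ := exists_gappedSet hD hF
  rw [laplaceCalc_eq, laplaceCalc_eq]
  refine cfc_congr fun x hx => ?_
  rcases hK.cases h1 hx with rfl | rfl | ⟨-, -, -, hp⟩
  · simp [calcFun]
  · simp [calcFun, h]
  · simp [calcFun, h _ hp.le]

theorem norm_calc_le (hD : IsSelfAdjoint D) (hF : IsFredholm D) {f : ℝ → ℂ} {C : ℝ} (hC : 0 ≤ C)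
    (h : ∀ μ, 0 ≤ μ → ‖f μ‖ ≤ C) : ‖laplaceCalc D f‖ ≤ C := by
  obtain ⟨θ, -, h1, hK⟩ := exists_gappedSet hD hF
  rw [laplaceCalc_eq]
  refine norm_cfc_le hC fun x hx => ?_
  rcases hK.cases h1 hx with rfl | rfl | ⟨-, -, -, hp⟩
  · simpa [calcFun] using hC
  · simpa [calcFun] using h 0 le_rfl
  · unfold calcFun
    split_ifs
    · simpa using hC
    · exact h _ hp.le

theorem calc_inv (hD : IsSelfAdjoint D) (hF : IsFredholm D) :
    laplaceCalc D (fun μ : ℝ => ((1 + μ : ℝ) : ℂ)⁻¹) = invOneAddSq D := by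
  obtain ⟨θ, -, h1, hK⟩ := exists_gappedSet hD hF
  have hR := resolvent_normal hD
  rw [laplaceCalc_eq]
  conv_rhs => rw [← cfc_id' ℂ (invOneAddSq D)]
  refine cfc_congr fun x hx => ?_
  simp only [calcFun]
  split_ifs with h
  · exact h.symm
  · conv_rhs => rw [(hK x hx).2.1]
    rw [add_sub_cancel, Complex.ofReal_inv, inv_inv]

theorem calc_commute (hD : IsSelfAdjoint D) (hF : IsFredholm D) (f : ℝ → ℂ) :
    Commute (laplaceCalc D f) (invOneAddSq D) := by
  rw [← calc_inv hD hF, laplaceCalc_eq, laplaceCalc_eq]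
  exact cfc_commute_cfc _ _ _

/-- This identifies the spectral projection at `0` with `Π`: its range lies in the eigenspace of the
resolvent for `1`, it fixes the kernel, and it is self-adjoint. -/
theorem calc_indicator (hD : IsSelfAdjoint D) (hF : IsFredholm D)
    [(kernel D).HasOrthogonalProjection] :
    laplaceCalc D (fun μ => if μ = 0 then 1 else 0) = (kernel D).starProjection := by
  have hR := resolvent_normal hD
  set f : ℝ → ℂ := fun μ => if μ = 0 then 1 else 0 with hf
  have hfa : Admissible f := admissible_indicator
  set E := laplaceCalc D f with hE
  have hRE : invOneAddSq D * E = E := by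
    rw [← calc_inv hD hF, hE, ← calc_mul hD hF admissible_inv hfa]
    refine calc_congr hD hF fun μ _ => ?_
    simp only [hf]
    split_ifs with h <;> simp [h]
  have hEsa : IsSelfAdjoint E := by
    rw [isSelfAdjoint_iff, hE, laplaceCalc_eq, ← cfc_star]
    refine congrArg (fun g => cfc g (invOneAddSq D)) ?_
    ext x
    simp only [calcFun, hf]
    split_ifs <;> simp
  -- `1 - E` is a multiple of `1 - (1 + Δ)⁻¹`
  have hEk : ∀ v ∈ kernel D, E v = v := by
    intro v hv
    rw [mem_kernel_iff_resolvent hD] at hv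
    obtain ⟨g, hg, hgf⟩ : ∃ g : ℝ → ℂ, Admissible g ∧
        ∀ μ, 0 ≤ μ → ((1 + μ : ℝ) : ℂ)⁻¹ - f μ =
          g μ - g μ * ((1 + μ : ℝ) : ℂ)⁻¹ := by
      -- With `g = μ⁻¹` off `0`, the difference `(1 + Δ)⁻¹ - E` equals `g(Δ)(1 - (1 + Δ)⁻¹)`, which
      -- kills `v`. The resolvent replaces `1` because constants do not vanish at infinity.
      refine ⟨fun μ => if μ = 0 then 0 else (μ : ℂ) ^ (-1 : ℂ), admissible_cpow (by simp), ?_⟩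
      intro μ hμ
      simp only [hf]
      split_ifs with h
      · simp [h]
      · have h1 : (1 + μ : ℂ) ≠ 0 := by
          have : 1 + μ ≠ 0 := by positivity
          exact_mod_cast this
        have h2 : (μ : ℂ) ≠ 0 := by exact_mod_cast h
        rw [Complex.cpow_neg_one]
        push_cast
        field_simp
        ring
    have h1 := calc_congr hD hF hgf
    rw [calc_sub hD hF admissible_inv hfa, calc_sub hD hF hg (hg.mul admissible_inv),
      calc_mul hD hF hg admissible_inv, calc_inv hD hF] at h1
    have h2 := congrArg (fun B : H →L[ℂ] H => B v) h1
    simp only [sub_apply, mul_apply_eq_comp, hv, sub_self] at h2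
    exact (sub_eq_zero.1 h2).symm
  have hmem : ∀ v, E v ∈ kernel D := fun v => by
    rw [mem_kernel_iff_resolvent hD, ← mul_apply_eq_comp, hRE]
  ext v
  refine (Submodule.eq_starProjection_of_mem_orthogonal (hmem v) fun w hw => ?_).symm
  have h3 := (ContinuousLinearMap.isSelfAdjoint_iff_isSymmetric.1 hEsa) w v
  change inner ℂ (E w) v = inner ℂ w (E v) at h3
  rw [inner_sub_right, ← h3, hEk w hw, sub_self]

/-- `e^{-tΔ}` factors as `(1 + Δ)^{-s}` times the bounded operator `(1 + Δ)^s e^{-tΔ}`, for every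
`s`. -/
theorem heat_mem_smooth (hD : IsSelfAdjoint D) (hF : IsFredholm D) {t : ℝ} (ht : 0 < t) (v : H) :
    heat D t v ∈ smooth D := by
  rw [mem_smooth_iff hD]
  have key : ∀ s : ℕ, ∃ B : H →L[ℂ] H, heat D t = invOneAddSq D ^ s * B := fun s => by
    have hpow : ∀ j : ℕ, invOneAddSq D ^ j * laplaceCalc D (fun μ =>
        (((((1 : Polynomial ℝ) + Polynomial.X) ^ j).eval μ * Real.exp (-(t * μ)) : ℝ) : ℂ)) =
          heat D t := by
      intro j
      induction j with
      | zero => simp [heat]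
      | succ j ih =>
        rw [pow_succ, mul_assoc]
        conv_lhs => enter [2, 1]; rw [← calc_inv hD hF]
        rw [← calc_mul hD hF admissible_inv (admissible_pow_mul_exp _ ht), ← ih]
        congr 1
        refine calc_congr hD hF fun μ hμ => ?_
        have h1 : (1 + μ : ℂ) ≠ 0 := by
          have : 1 + μ ≠ 0 := by positivity
          exact_mod_cast this
        simp only [Polynomial.eval_pow, Polynomial.eval_add, Polynomial.eval_one,
          Polynomial.eval_X]
        push_cast
        rw [pow_succ]
        field_simp
    exact ⟨_, (hpow s).symm⟩
  intro s
  obtain ⟨B, hB⟩ := key (s + 1)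
  exact ⟨B v, by rw [hB]; rfl⟩

theorem admissible_exp {t : ℝ} (ht : 0 < t) :
    Admissible fun μ : ℝ => (Real.exp (-(t * μ)) : ℂ) :=
  (admissible_pow_mul_exp 1 ht).congr fun μ _ => by simp

/-- `1 - e^{-tμ} ≤ tμ ≤ t(1 + μ)`. -/
theorem norm_heat_mul_sub_le (hD : IsSelfAdjoint D) (hF : IsFredholm D) {t : ℝ} (ht : 0 < t) :
    ‖heat D t * invOneAddSq D - invOneAddSq D‖ ≤ t := by
  have h : heat D t * invOneAddSq D - invOneAddSq D = laplaceCalc D (fun μ =>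
      (Real.exp (-(t * μ)) : ℂ) * ((1 + μ : ℝ) : ℂ)⁻¹ - ((1 + μ : ℝ) : ℂ)⁻¹) := by
    rw [calc_sub hD hF ((admissible_exp ht).mul admissible_inv) admissible_inv,
      calc_mul hD hF (admissible_exp ht) admissible_inv, calc_inv hD hF]
    rfl
  rw [h]
  refine norm_calc_le hD hF ht.le fun μ hμ => ?_
  have h1 : (Real.exp (-(t * μ)) : ℂ) * ((1 + μ : ℝ) : ℂ)⁻¹ - ((1 + μ : ℝ) : ℂ)⁻¹ =
      (((Real.exp (-(t * μ)) - 1) * (1 + μ)⁻¹ : ℝ) : ℂ) := by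
    push_cast
    ring
  rw [h1, Complex.norm_real, norm_mul, Real.norm_eq_abs, norm_inv,
    Real.norm_of_nonneg (by positivity : (0 : ℝ) ≤ 1 + μ), ← div_eq_mul_inv,
    div_le_iff₀ (by positivity), abs_sub_comm, abs_of_nonneg]
  · have := Real.add_one_le_exp (-(t * μ))
    nlinarith
  · rw [sub_nonneg]
    exact Real.exp_le_one_iff.2 (by nlinarith)

/-- The range of the resolvent is dense, and heat smoothing approximates each of its elements by
smooth vectors. Density is what makes the extensions of `X B` by continuity unique. -/
theorem dense_smooth (hD : IsSelfAdjoint D) (hF : IsFredholm D) : Dense (smooth D : Set H) := by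
  rw [← dense_closure]
  refine Dense.mono ?_ (denseRange_resolvent hD)
  rintro _ ⟨v, rfl⟩
  refine mem_closure_of_tendsto (b := 𝓝[>] (0 : ℝ)) (f := fun t => heat D t (invOneAddSq D v)) ?_
    (eventually_nhdsWithin_of_forall fun t ht => heat_mem_smooth hD hF ht _)
  rw [tendsto_iff_norm_sub_tendsto_zero]
  have hlim : Tendsto (fun t : ℝ => t * ‖v‖) (𝓝[>] 0) (𝓝 0) :=
    ((continuous_id.mul continuous_const).tendsto' 0 0 (by simp)).mono_left nhdsWithin_le_nhds
  refine squeeze_zero' (.of_forall fun _ => norm_nonneg _)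
    (eventually_nhdsWithin_of_forall fun t ht => ?_) hlim
  have := (heat D t * invOneAddSq D - invOneAddSq D).le_opNorm v
  exact this.trans (by gcongr; exact norm_heat_mul_sub_le hD hF ht)

end Laplace

open Set MeasureTheory

/-! ### The Mellin transform of `Δ^σ e^{-tΔ}`. -/

section HeatPower

variable {H : Type*} [NormedAddCommGroup H] [InnerProductSpace ℂ H] [CompleteSpace H]
  {D : H →ₗ.[ℂ] H}

variable (D) in
/-- The operator `Δ ^ σ e^{-tΔ}`, for `t > 0`. -/
def heatPow (σ : ℕ) (t : ℝ) : H →L[ℂ] H :=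
  laplaceCalc D fun μ => ((μ ^ σ * Real.exp (-(t * μ)) : ℝ) : ℂ)

theorem admissible_heatPow (σ : ℕ) {t : ℝ} (ht : 0 < t) :
    Admissible fun μ : ℝ => ((μ ^ σ * Real.exp (-(t * μ)) : ℝ) : ℂ) :=
  (admissible_pow_mul_exp (Polynomial.X ^ σ) ht).congr fun μ _ => by simp

theorem pow_mul_exp_neg_le (σ : ℕ) {t μ : ℝ} (ht : 0 < t) (hμ : 0 ≤ μ) :
    μ ^ σ * Real.exp (-(t * μ)) ≤ σ.factorial * t ^ (-(σ : ℝ)) := by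
  have h := Real.pow_div_factorial_le_exp (t * μ) (by positivity) σ
  rw [div_le_iff₀ (by positivity), mul_pow] at h
  rw [Real.exp_neg, Real.rpow_neg ht.le, Real.rpow_natCast, ← div_eq_mul_inv, ← div_eq_mul_inv,
    div_le_div_iff₀ (Real.exp_pos _) (by positivity)]
  linarith

/-- Half of the exponential absorbs `μ ^ σ`; the other half is kept as decay in `t`. -/
theorem pow_mul_exp_neg_le_of_le (σ : ℕ) {t μ m : ℝ} (ht : 0 < t) (hm : 0 < m) (hμ : m ≤ μ) :
    μ ^ σ * Real.exp (-(t * μ)) ≤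
      (σ.factorial * 2 ^ (σ : ℝ)) * (t ^ (-(σ : ℝ)) * Real.exp (-(m / 2) * t)) := by
  have h := pow_mul_exp_neg_le σ (half_pos ht) (hm.le.trans hμ)
  have h1 : Real.exp (-(t * μ)) = Real.exp (-(t / 2 * μ)) * Real.exp (-(t / 2 * μ)) := by
    rw [← Real.exp_add]
    congr 1
    ring
  have h2 : Real.exp (-(t / 2 * μ)) ≤ Real.exp (-(m / 2) * t) := by
    refine Real.exp_le_exp.2 ?_
    nlinarith
  have h3 : (t / 2) ^ (-(σ : ℝ)) = t ^ (-(σ : ℝ)) * 2 ^ (σ : ℝ) := by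
    rw [Real.div_rpow ht.le zero_le_two, Real.rpow_neg zero_le_two, div_inv_eq_mul]
  rw [h3] at h
  calc μ ^ σ * Real.exp (-(t * μ))
      = μ ^ σ * Real.exp (-(t / 2 * μ)) * Real.exp (-(t / 2 * μ)) := by rw [h1, mul_assoc]
    _ ≤ σ.factorial * (t ^ (-(σ : ℝ)) * 2 ^ (σ : ℝ)) * Real.exp (-(m / 2) * t) := by gcongr
    _ = _ := by ring

/-- For `σ ≠ 0` the factor `μ ^ σ` vanishes on the kernel, and the rest of the spectrum lies above
`θ⁻¹ - 1 > 0`. -/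
theorem exists_norm_calcFun_heatPow_le {σ : ℕ} (hσ : σ ≠ 0) {θ : ℝ} (h0 : 0 < θ) (h1 : θ < 1)
    {K : Set ℂ} (hK : GappedSet θ K) : ∃ C m : ℝ, 0 ≤ C ∧ 0 < m ∧ ∀ t, 0 < t → ∀ x ∈ K,
      ‖calcFun (fun μ => ((μ ^ σ * Real.exp (-(t * μ)) : ℝ) : ℂ)) x‖ ≤
        C * (t ^ (-(σ : ℝ)) * Real.exp (-m * t)) := by
  have hm : 0 < θ⁻¹ - 1 := sub_pos.2 ((one_lt_inv₀ h0).2 h1)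
  refine ⟨σ.factorial * 2 ^ (σ : ℝ), (θ⁻¹ - 1) / 2, by positivity, by positivity,
    fun t ht x hx => ?_⟩
  rcases hK.cases h1 hx with rfl | rfl | ⟨hp, -, hle, hp'⟩
  · simp only [calcFun, if_true, norm_zero]
    positivity
  · simp only [calcFun, one_ne_zero, if_false, Complex.one_re, inv_one, sub_self, ne_eq, hσ,
      not_false_eq_true, zero_pow, zero_mul, Complex.ofReal_zero, norm_zero]
    positivity
  · have hx0 : x ≠ 0 := fun h => by simp [h] at hp
    rw [calcFun, if_neg hx0, Complex.norm_real, Real.norm_of_nonneg (by positivity)]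
    exact pow_mul_exp_neg_le_of_le σ ht hm hle

theorem integrableOn_rpow_mul_exp {C m u : ℝ} (hm : 0 < m) (hu : -1 < u) :
    IntegrableOn (fun t : ℝ => C * (t ^ u * Real.exp (-m * t))) (Ioi 0) := by
  have := (integrableOn_rpow_mul_exp_neg_mul_rpow (p := 1) hu one_pos hm).const_mul C
  simpa [IntegrableOn] using this

theorem continuousOn_cpow_mul_heatPow {σ : ℕ} (hσ : σ ≠ 0) (w : ℂ) {θ : ℝ} (h1 : θ < 1)
    {K : Set ℂ} (hK : GappedSet θ K) :
    ContinuousOn (Function.uncurry fun t : ℝ => calcFun fun μ =>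
      (t : ℂ) ^ w * ((μ ^ σ * Real.exp (-(t * μ)) : ℝ) : ℂ)) (Ioi 0 ×ˢ K) := by
  have hc : ContinuousOn (fun t : ℝ => (t : ℂ) ^ w) (Ioi 0) := fun t ht =>
    (Complex.continuousAt_ofReal_cpow_const _ _ (Or.inr (ne_of_gt ht))).continuousWithinAt
  refine continuousOn_calcFun_param h1 hK ?_ ?_ fun t ht => ?_
  · refine (hc.comp continuousOn_fst fun p hp => hp.1).mul (Continuous.continuousOn ?_)
    fun_prop
  · simp only [ne_eq, hσ, not_false_eq_true, zero_pow, zero_mul, Complex.ofReal_zero, mul_zero]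
    exact continuousOn_const
  · -- `(tμ)^(σ+1) e^{-tμ} ≤ (σ+1)!` gives decay like `μ⁻¹`, locally uniformly in `t`
    have hg : Tendsto (fun p : ℝ × ℝ => ‖(p.1 : ℂ) ^ w‖ *
        (((σ + 1).factorial * p.1 ^ (-((σ + 1 : ℕ) : ℝ))) * p.2⁻¹)) (𝓝[Ioi 0] t ×ˢ atTop) (𝓝 0) := by
      have ha : Tendsto (fun s : ℝ => ‖(s : ℂ) ^ w‖) (𝓝[Ioi 0] t) (𝓝 ‖(t : ℂ) ^ w‖) :=
        (hc t ht).norm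
      have hb : Tendsto (fun s : ℝ => ((σ + 1).factorial * s ^ (-((σ + 1 : ℕ) : ℝ))))
          (𝓝[Ioi 0] t) (𝓝 ((σ + 1).factorial * t ^ (-((σ + 1 : ℕ) : ℝ)))) :=
        ((Real.continuousAt_rpow_const _ _ (Or.inl (ne_of_gt ht))).tendsto.const_mul _).mono_left
          nhdsWithin_le_nhds
      have := (ha.comp tendsto_fst).mul
        ((hb.comp tendsto_fst).mul (tendsto_inv_atTop_zero.comp tendsto_snd))
      simpa using this
    refine squeeze_zero_norm' ?_ hg
    have hev : ∀ᶠ p : ℝ × ℝ in 𝓝[Ioi 0] t ×ˢ atTop, 0 < p.1 ∧ 0 < p.2 :=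
      (eventually_mem_nhdsWithin).prod_mk (eventually_gt_atTop 0)
    filter_upwards [hev] with p hp
    simp only [Function.uncurry]
    rw [norm_mul, Complex.norm_real, Real.norm_of_nonneg (by have := hp.2; positivity)]
    refine mul_le_mul_of_nonneg_left ?_ (norm_nonneg _)
    rw [← div_eq_mul_inv, le_div_iff₀ hp.2]
    have := pow_mul_exp_neg_le (σ + 1) hp.1 hp.2.le
    rw [pow_succ] at this
    linarith

/-- Euler's integral for `Γ` when `μ > 0`; at `x = 0` and `x = 1` both sides vanish. -/
theorem integral_cpow_mul_heatPow {σ : ℕ} (hσ : σ ≠ 0) {z : ℂ} (hz : 0 < z.re)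
    {θ : ℝ} (h1 : θ < 1) {K : Set ℂ} (hK : GappedSet θ K) {x : ℂ} (hx : x ∈ K) :
    ∫ t : ℝ in Ioi 0, calcFun (fun μ =>
      (t : ℂ) ^ (z - 1) * ((μ ^ σ * Real.exp (-(t * μ)) : ℝ) : ℂ)) x =
        Complex.Gamma z * calcFun (fun μ : ℝ => if μ = 0 then 0 else (μ : ℂ) ^ (-(z - σ))) x := by
  rcases hK.cases h1 hx with rfl | rfl | ⟨hp, -, -, hp'⟩
  · simp [calcFun]
  · simp [calcFun, hσ]
  · have hx0 : x ≠ 0 := fun h => by simp [h] at hp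
    set μ := x.re⁻¹ - 1 with hμ
    have hμ0 : (μ : ℂ) ≠ 0 := by exact_mod_cast hp'.ne'
    simp only [calcFun, if_neg hx0, ← hμ, if_neg hp'.ne']
    have h2 := Complex.integral_cpow_mul_exp_neg_mul_Ioi hz hp'
    calc ∫ t : ℝ in Ioi 0, (t : ℂ) ^ (z - 1) * ((μ ^ σ * Real.exp (-(t * μ)) : ℝ) : ℂ)
        = ∫ t : ℝ in Ioi 0, (μ : ℂ) ^ σ * ((t : ℂ) ^ (z - 1) * Complex.exp (-(μ * t))) := by
          congr 1
          ext t
          push_cast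
          rw [mul_comm (t : ℂ) (μ : ℂ)]
          ring
      _ = (μ : ℂ) ^ σ * ((1 / (μ : ℂ)) ^ z * Complex.Gamma z) := by
          rw [integral_const_mul, h2]
      _ = Complex.Gamma z * (μ : ℂ) ^ (-(z - σ)) := by
          have h3 : (1 / (μ : ℂ)) ^ z = (μ : ℂ) ^ (-z) := by
            rw [one_div, Complex.inv_cpow _ _ ?_, Complex.cpow_neg]
            rw [Complex.arg_ofReal_of_nonneg hp'.le]
            exact Real.pi_pos.ne
          rw [h3, neg_sub, sub_eq_add_neg, Complex.cpow_add _ _ hμ0, Complex.cpow_natCast]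
          ring

theorem heatPow_smul_eq_cfc (hD : IsSelfAdjoint D) (hF : IsFredholm D) (σ : ℕ) (c : ℂ)
    {t : ℝ} (ht : 0 < t) :
    c • heatPow D σ t = cfc (calcFun fun μ => c * ((μ ^ σ * Real.exp (-(t * μ)) : ℝ) : ℂ))
      (invOneAddSq D) := by
  obtain ⟨θ, h0, h1, hK⟩ := exists_gappedSet hD hF
  have hR := resolvent_normal hD
  rw [heatPow, laplaceCalc_eq,
    ← cfc_smul c _ _ ((admissible_heatPow σ ht).continuousOn_calcFun h1 hK)]
  congr 1
  ext x
  unfold calcFun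
  split_ifs <;> simp

/-- The integrand is bounded by a multiple of `t^{Re z - 1 - σ} e^{-mt}`, integrable at `0` because
`Re z > σ`. The continuous functional calculus then commutes with the integral and reduces the claim
to scalars. -/
theorem mellin_heatPow (hD : IsSelfAdjoint D) (hF : IsFredholm D) {σ : ℕ} (hσ : σ ≠ 0) {z : ℂ}
    (hz : σ < z.re) :
    IntegrableOn (fun t : ℝ => (t : ℂ) ^ (z - 1) • heatPow D σ t) (Ioi 0) ∧
      ∫ t : ℝ in Ioi 0, (t : ℂ) ^ (z - 1) • heatPow D σ t =
        Complex.Gamma z • cpowNeg D (z - σ) := by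
  obtain ⟨θ, h0, h1, hK⟩ := exists_gappedSet hD hF
  have hR := resolvent_normal hD
  obtain ⟨C, m, hC, hm, hle⟩ := exists_norm_calcFun_heatPow_le hσ h0 h1 hK
  have hz0 : 0 < z.re := (Nat.cast_nonneg σ).trans_lt hz
  have hcont := continuousOn_cpow_mul_heatPow hσ (z - 1) h1 hK
  have hfin : HasFiniteIntegral
      (fun t : ℝ => C * (t ^ (z.re - 1 - σ) * Real.exp (-m * t))) (volume.restrict (Ioi 0)) :=
    (integrableOn_rpow_mul_exp hm (by linarith)).hasFiniteIntegral
  have hbound : ∀ᵐ t : ℝ ∂(volume.restrict (Ioi 0)), ∀ x ∈ spectrum ℂ (invOneAddSq D),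
      ‖calcFun (fun μ => (t : ℂ) ^ (z - 1) * ((μ ^ σ * Real.exp (-(t * μ)) : ℝ) : ℂ)) x‖ ≤
        C * (t ^ (z.re - 1 - σ) * Real.exp (-m * t)) := by
    refine ae_restrict_of_forall_mem measurableSet_Ioi fun t ht x hx => ?_
    have ht0 : 0 < t := ht
    have hfac : calcFun (fun μ => (t : ℂ) ^ (z - 1) * ((μ ^ σ * Real.exp (-(t * μ)) : ℝ) : ℂ)) x =
        (t : ℂ) ^ (z - 1) * calcFun (fun μ => ((μ ^ σ * Real.exp (-(t * μ)) : ℝ) : ℂ)) x := by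
      unfold calcFun
      split_ifs <;> simp
    rw [hfac, norm_mul, Complex.norm_cpow_eq_rpow_re_of_pos ht0, Complex.sub_re, Complex.one_re,
      sub_eq_add_neg (z.re - 1), Real.rpow_add ht0]
    calc _ ≤ t ^ (z.re - 1) * (C * (t ^ (-(σ : ℝ)) * Real.exp (-m * t))) := by
          gcongr
          exact hle t ht0 x hx
      _ = _ := by ring
  have hcongr : EqOn (fun t : ℝ => (t : ℂ) ^ (z - 1) • heatPow D σ t) (fun t : ℝ =>
      cfc (calcFun fun μ => (t : ℂ) ^ (z - 1) * ((μ ^ σ * Real.exp (-(t * μ)) : ℝ) : ℂ))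
        (invOneAddSq D)) (Ioi 0) := fun t ht => heatPow_smul_eq_cfc hD hF σ _ ht
  constructor
  · rw [integrableOn_congr_fun hcongr measurableSet_Ioi]
    exact integrableOn_cfc measurableSet_Ioi _ _ _ hcont hbound hfin
  · rw [setIntegral_congr_fun measurableSet_Ioi hcongr,
      ← cfc_setIntegral measurableSet_Ioi _ _ _ hcont hbound hfin, cpowNeg, laplaceCalc_eq,
      ← cfc_smul (Complex.Gamma z) _ _ ((admissible_cpow (z := z - σ) ?_).continuousOn_calcFun h1 hK)]
    · exact cfc_congr fun x hx => integral_cpow_mul_heatPow hσ hz0 h1 hK hx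
    · simpa using hz

theorem exists_norm_heatPow_le (hD : IsSelfAdjoint D) (hF : IsFredholm D) {σ : ℕ} (hσ : σ ≠ 0) :
    ∃ C m : ℝ, 0 < m ∧ ∀ t, 0 < t →
      ‖heatPow D σ t‖ ≤ C * (t ^ (-(σ : ℝ)) * Real.exp (-m * t)) := by
  obtain ⟨θ, h0, h1, hK⟩ := exists_gappedSet hD hF
  obtain ⟨C, m, hC, hm, hle⟩ := exists_norm_calcFun_heatPow_le hσ h0 h1 hK
  refine ⟨C, m, hm, fun t ht => ?_⟩
  rw [heatPow, laplaceCalc_eq]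
  exact norm_cfc_le (by positivity) (hle t ht)

theorem cpowNeg_mul_cpowNeg (hD : IsSelfAdjoint D) (hF : IsFredholm D) {z w : ℂ} (hz : 0 < z.re)
    (hw : 0 < w.re) : cpowNeg D z * cpowNeg D w = cpowNeg D (z + w) := by
  rw [cpowNeg, cpowNeg, ← calc_mul hD hF (admissible_cpow hz) (admissible_cpow hw)]
  refine calc_congr hD hF fun μ _ => ?_
  split_ifs with h
  · simp
  · rw [← Complex.cpow_add _ _ (by exact_mod_cast h), neg_add]

/-- `Δ^{-σ} Δ^σ` is `1 - Π`, not `1`; this is where the kernel term of the heat trace originates. -/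
theorem cpowNeg_mul_heatPow (hD : IsSelfAdjoint D) (hF : IsFredholm D)
    [(kernel D).HasOrthogonalProjection] {σ : ℕ} (hσ : σ ≠ 0) {t : ℝ} (ht : 0 < t) :
    cpowNeg D σ * heatPow D σ t = heat D t - (kernel D).starProjection := by
  have hσ' : 0 < ((σ : ℂ)).re := by simpa using Nat.pos_of_ne_zero hσ
  rw [← calc_indicator hD hF, heat, ← calc_sub hD hF (admissible_exp ht) admissible_indicator,
    cpowNeg, heatPow, ← calc_mul hD hF (admissible_cpow hσ') (admissible_heatPow σ ht)]
  refine calc_congr hD hF fun μ _ => ?_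
  split_ifs with h
  · simp [h]
  · have h' : (μ : ℂ) ≠ 0 := by exact_mod_cast h
    rw [Complex.cpow_neg, Complex.cpow_natCast]
    push_cast
    field_simp
    ring

theorem cpowNeg_mem_smooth (hD : IsSelfAdjoint D) (hF : IsFredholm D) (z : ℂ) {v : H}
    (hv : v ∈ smooth D) : cpowNeg D z v ∈ smooth D :=
  mem_smooth_of_commute hD (calc_commute hD hF _) hv

end HeatPower

/-! ### Trace class operators and the trace. -/

section Trace

variable {H : Type*} [NormedAddCommGroup H] [InnerProductSpace ℂ H]

/-- Cauchy–Schwarz and Bessel; the bound justifies exchanging the sums in the trace. -/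
theorem sum_norm_inner_mul_inner_le {ι : Type*} {b : ι → H} (hb : Orthonormal ℂ b) (x y : H)
    (s : Finset ι) :
    ∑ i ∈ s, ‖inner ℂ y (b i) * inner ℂ (b i) x‖ ≤ ‖y‖ * ‖x‖ := by
  have h : ∀ z : H, √(∑ i ∈ s, ‖inner ℂ (b i) z‖ ^ 2) ≤ ‖z‖ := fun z =>
    Real.sqrt_le_iff.2 ⟨norm_nonneg _, hb.sum_inner_products_le z⟩
  calc ∑ i ∈ s, ‖inner ℂ y (b i) * inner ℂ (b i) x‖
      = ∑ i ∈ s, ‖inner ℂ (b i) y‖ * ‖inner ℂ (b i) x‖ :=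
        Finset.sum_congr rfl fun i _ => by rw [norm_mul, norm_inner_symm]
    _ ≤ √(∑ i ∈ s, ‖inner ℂ (b i) y‖ ^ 2) * √(∑ i ∈ s, ‖inner ℂ (b i) x‖ ^ 2) :=
        Real.sum_mul_le_sqrt_mul_sqrt _ _ _
    _ ≤ ‖y‖ * ‖x‖ := mul_le_mul (h y) (h x) (Real.sqrt_nonneg _) (norm_nonneg _)

/-- Fubini for the double family `f`: summing over the basis first is Parseval, summing over `j`
first gives the diagonal entries of `S`. -/
theorem hasSum_inner_of_nuclear {ι : Type*} (b : HilbertBasis ι ℂ H) {S : H →L[ℂ] H} {x y : ℕ → H}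
    (hxy : Summable fun j => ‖x j‖ * ‖y j‖)
    (hS : ∀ v, HasSum (fun j => inner ℂ (y j) v • x j) (S v)) :
    HasSum (fun i => inner ℂ (b i) (S (b i))) (∑' j, inner ℂ (y j) (x j)) := by
  set f : ℕ × ι → ℂ := fun p => inner ℂ (y p.1) (b p.2) * inner ℂ (b p.2) (x p.1) with hf
  have hle := fun j s => sum_norm_inner_mul_inner_le b.orthonormal (x j) (y j) s
  have hsum : Summable f := by
    refine Summable.of_norm ((summable_prod_of_nonneg fun _ => norm_nonneg _).2 ⟨fun j => ?_, ?_⟩)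
    · exact summable_of_sum_le (fun _ => norm_nonneg _) (hle j)
    · refine Summable.of_nonneg_of_le (fun j => tsum_nonneg fun _ => norm_nonneg _)
        (fun j => ?_) hxy
      rw [mul_comm]
      exact Real.tsum_le_of_sum_le (fun _ => norm_nonneg _) (hle j)
  have h1 : ∑' j, inner ℂ (y j) (x j) = ∑' p, f p :=
    (hsum.hasSum.prod_fiberwise fun j => b.hasSum_inner_mul_inner (y j) (x j)).tsum_eq
  rw [h1]
  refine ((Equiv.prodComm ι ℕ).hasSum_iff.2 hsum.hasSum).prod_fiberwise fun i => ?_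
  have := (hS (b i)).mapL (innerSL ℂ (b i))
  simpa [inner_smul_right, hf] using! this

variable [CompleteSpace H]

theorem hasSum_opTrace {S : H →L[ℂ] H} {x y : ℕ → H}
    (hxy : Summable fun j => ‖x j‖ * ‖y j‖)
    (hS : ∀ v, HasSum (fun j => inner ℂ (y j) v • x j) (S v)) :
    HasSum (fun i => inner ℂ ((exists_hilbertBasis ℂ H).choose_spec.choose i)
      (S ((exists_hilbertBasis ℂ H).choose_spec.choose i))) (∑' j, inner ℂ (y j) (x j)) :=
  hasSum_inner_of_nuclear _ hxy hS

theorem opTrace_eq {S : H →L[ℂ] H} {x y : ℕ → H}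
    (hxy : Summable fun j => ‖x j‖ * ‖y j‖)
    (hS : ∀ v, HasSum (fun j => inner ℂ (y j) v • x j) (S v)) :
    opTrace S = ∑' j, inner ℂ (y j) (x j) :=
  (hasSum_opTrace hxy hS).tsum_eq

theorem opTrace_add {S S' : H →L[ℂ] H} (hS : IsTraceClass S) (hS' : IsTraceClass S') :
    opTrace (S + S') = opTrace S + opTrace S' := by
  obtain ⟨x, y, hxy, h⟩ := hS
  obtain ⟨x', y', hxy', h'⟩ := hS'
  unfold opTrace
  rw [← (hasSum_opTrace hxy h).summable.tsum_add (hasSum_opTrace hxy' h').summable]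
  simp

omit [CompleteSpace H] in
theorem summable_mul_clm {x y : ℕ → H} (hxy : Summable fun j => ‖x j‖ * ‖y j‖) (B C : H →L[ℂ] H) :
    Summable fun j => ‖B (x j)‖ * ‖C (y j)‖ := by
  refine Summable.of_nonneg_of_le (fun j => by positivity) (fun j => ?_)
    (hxy.mul_left (‖B‖ * ‖C‖))
  calc ‖B (x j)‖ * ‖C (y j)‖ ≤ (‖B‖ * ‖x j‖) * (‖C‖ * ‖y j‖) := by
        gcongr <;> exact ContinuousLinearMap.le_opNorm _ _
    _ = ‖B‖ * ‖C‖ * (‖x j‖ * ‖y j‖) := by ring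

theorem nuclear_mul_mul {S : H →L[ℂ] H} {x y : ℕ → H}
    (hS : ∀ v, HasSum (fun j => inner ℂ (y j) v • x j) (S v)) (B C : H →L[ℂ] H) (v : H) :
    HasSum (fun j => inner ℂ (C.adjoint (y j)) v • B (x j)) ((B * S * C) v) := by
  have := (hS (C v)).mapL B
  simpa [ContinuousLinearMap.adjoint_inner_left] using! this

theorem IsTraceClass.mul_mul {S : H →L[ℂ] H} (hS : IsTraceClass S) (B C : H →L[ℂ] H) :
    IsTraceClass (B * S * C) := by
  obtain ⟨x, y, hxy, h⟩ := hS
  exact ⟨_, _, summable_mul_clm hxy B C.adjoint, nuclear_mul_mul h B C⟩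

/-- `B ↦ Tr (C S B)` is a bounded functional if `S` is trace class. -/
theorem exists_clm_opTrace {S : H →L[ℂ] H} (hS : IsTraceClass S) (C : H →L[ℂ] H) :
    ∃ L : (H →L[ℂ] H) →L[ℂ] ℂ, ∀ B, L B = opTrace (C * S * B) := by
  obtain ⟨x, y, hxy, h⟩ := hS
  have hval : ∀ B : H →L[ℂ] H, opTrace (C * S * B) = ∑' j, inner ℂ (y j) (B (C (x j))) := fun B => by
    rw [opTrace_eq (summable_mul_clm hxy C B.adjoint) (nuclear_mul_mul h C B)]
    simp [ContinuousLinearMap.adjoint_inner_left]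
  have hle : ∀ (B : H →L[ℂ] H) j,
      ‖inner ℂ (y j) (B (C (x j)))‖ ≤ ‖B‖ * ‖C‖ * (‖x j‖ * ‖y j‖) := fun B j => by
    calc ‖inner ℂ (y j) (B (C (x j)))‖ ≤ ‖y j‖ * ‖B (C (x j))‖ := norm_inner_le_norm _ _
      _ ≤ ‖y j‖ * (‖B‖ * (‖C‖ * ‖x j‖)) := by
        gcongr
        exact (B.le_opNorm _).trans (by gcongr; exact C.le_opNorm _)
      _ = _ := by ring
  have hsum : ∀ B : H →L[ℂ] H, Summable fun j => inner ℂ (y j) (B (C (x j))) := fun B =>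
    Summable.of_norm_bounded (hxy.mul_left _) (hle B)
  refine ⟨LinearMap.mkContinuous
    { toFun := fun B => ∑' j, inner ℂ (y j) (B (C (x j)))
      map_add' := fun B B' => by
        rw [← (hsum B).tsum_add (hsum B')]
        simp
      map_smul' := fun c B => by
        rw [RingHom.id_apply, smul_eq_mul, ← tsum_mul_left]
        simp } (‖C‖ * ∑' j, ‖x j‖ * ‖y j‖) fun B => ?_, fun B => (hval B).symm⟩
  calc ‖∑' j, inner ℂ (y j) (B (C (x j)))‖ ≤ ∑' j, ‖B‖ * ‖C‖ * (‖x j‖ * ‖y j‖) :=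
        tsum_of_norm_bounded (hxy.mul_left _).hasSum (hle B)
    _ = ‖C‖ * (∑' j, ‖x j‖ * ‖y j‖) * ‖B‖ := by rw [tsum_mul_left]; ring

omit [CompleteSpace H] in
theorem isTraceClass_of_finite_sum {ι : Type*} [Fintype ι] (x y : ι → H) {S : H →L[ℂ] H}
    (hS : ∀ v, S v = ∑ i, inner ℂ (y i) v • x i) : IsTraceClass S := by
  let e := Fintype.equivFin ι
  let ext : (ι → H) → ℕ → H := fun u j => if h : j < Fintype.card ι then u (e.symm ⟨j, h⟩) else 0
  have hz : ∀ u, ∀ j ∉ Finset.range (Fintype.card ι), ext u j = 0 := fun u j hj =>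
    dif_neg (by simpa using hj)
  refine ⟨ext x, ext y, summable_of_ne_finset_zero (s := Finset.range (Fintype.card ι))
    fun j hj => by rw [hz x j hj, norm_zero, zero_mul], fun v => ?_⟩
  have : S v = ∑ j ∈ Finset.range (Fintype.card ι), inner ℂ (ext y j) v • ext x j := by
    rw [hS, Finset.sum_range]
    refine Fintype.sum_equiv e _ _ fun i => ?_
    simp [ext]
  rw [this]
  exact hasSum_sum_of_ne_finset_zero fun j hj => by rw [hz x j hj, smul_zero]

end Trace

open Complex MeasureTheory Set

/-! ### Residues of meromorphic continuations. -/

theorem residue_congr {f g : ℂ → ℂ} {z₀ : ℂ} (h : f =ᶠ[𝓝[≠] z₀] g) :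
    residue f z₀ = residue g z₀ := by
  obtain ⟨ε, hε, hfg⟩ := Metric.mem_nhdsWithin_iff.1 h
  have key : ∀ᶠ ρ in 𝓝[>] (0 : ℝ), (2 * Real.pi * I)⁻¹ * ∮ z in C(z₀, ρ), f z =
      (2 * Real.pi * I)⁻¹ * ∮ z in C(z₀, ρ), g z := by
    filter_upwards [Ioo_mem_nhdsGT hε] with ρ hρ
    congr 1
    refine circleIntegral.integral_congr hρ.1.le fun z hz => hfg ⟨?_, ?_⟩
    · rw [Metric.mem_ball, mem_sphere_iff_norm.1 hz |> (dist_eq_norm z z₀).trans]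
      exact hρ.2
    · rintro rfl
      simp [hρ.1.ne] at hz
  unfold residue limUnder
  rw [map_congr key]

theorem residue_simple_pole {f g : ℂ → ℂ} {z₀ b : ℂ} (hg : AnalyticAt ℂ g z₀)
    (hf : f =ᶠ[𝓝[≠] z₀] fun z => b / (z - z₀) + g z) : residue f z₀ = b := by
  rw [residue_congr hf]
  refine Tendsto.limUnder_eq (Tendsto.congr' ?_ tendsto_const_nhds)
  obtain ⟨ε, hε, han⟩ := Metric.eventually_nhds_iff.1 hg.eventually_analyticAt
  filter_upwards [Ioo_mem_nhdsGT hε] with ρ hρ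
  have hgd : DifferentiableOn ℂ g (Metric.closedBall z₀ ρ) := fun z hz =>
    (han (lt_of_le_of_lt hz hρ.2)).differentiableAt.differentiableWithinAt
  have hg0 : (∮ z in C(z₀, ρ), g z) = 0 :=
    circleIntegral_eq_zero_of_differentiable_on_off_countable hρ.1.le countable_empty
      hgd.continuousOn fun z hz => (han ((Metric.mem_ball.1 hz.1).trans hρ.2)).differentiableAt
  have hgi : CircleIntegrable g z₀ ρ :=
    (hgd.continuousOn.mono Metric.sphere_subset_closedBall).circleIntegrable hρ.1.le
  have h1i : CircleIntegrable (fun z => b / (z - z₀)) z₀ ρ := by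
    refine ContinuousOn.circleIntegrable hρ.1.le (ContinuousOn.div (by fun_prop) (by fun_prop) ?_)
    intro z hz h0
    rw [sub_eq_zero] at h0
    subst h0
    simp [hρ.1.ne] at hz
  rw [circleIntegral.integral_add h1i hgi, hg0, add_zero]
  have : (∮ z in C(z₀, ρ), b / (z - z₀)) = b * (2 * Real.pi * I) := by
    simp_rw [div_eq_mul_inv]
    rw [circleIntegral.integral_const_mul, circleIntegral.integral_sub_center_inv _ hρ.1.ne']
  rw [this, mul_comm b, inv_mul_cancel_left₀ Complex.two_pi_I_ne_zero]

/-- Both functions equal `f` far to the right; the identity theorem carries this through the common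
half-plane. Hence the choice made in `contResidue` is immaterial. -/
theorem eventuallyEq_of_continuations {f F G : ℂ → ℂ} {z₀ : ℂ}
    (hF : IsMeromorphicContinuation f z₀ F) (hG : IsMeromorphicContinuation f z₀ G) :
    F =ᶠ[𝓝[≠] z₀] G := by
  obtain ⟨s, s', hs, hFm, hFf⟩ := hF
  obtain ⟨u, u', hu, hGm, hGf⟩ := hG
  set U : Set ℂ := {z | max s' u' < z.re} with hU
  have hpre : IsPreconnected U := (convex_halfSpace_re_gt _).isPreconnected
  have hFU : MeromorphicOn F U := hFm.mono_set fun z hz => lt_of_le_of_lt (le_max_left s' u') hz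
  have hGU : MeromorphicOn G U := hGm.mono_set fun z hz => lt_of_le_of_lt (le_max_right s' u') hz
  have hsub : MeromorphicOn (F - G) U := hFU.sub hGU
  set y : ℂ := ((max (max s u) (max s' u') + 1 : ℝ) : ℂ) with hy
  have hyre : y.re = max (max s u) (max s' u') + 1 := by simp [hy]
  have hyU : y ∈ U := by
    change _ < y.re
    rw [hyre]
    linarith [le_max_right (max s u) (max s' u')]
  have hytop : meromorphicOrderAt (F - G) y = ⊤ := by
    rw [meromorphicOrderAt_eq_top_iff]
    have hopen : IsOpen {z : ℂ | max s u < z.re} := isOpen_lt continuous_const continuous_re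
    have hmem : {z : ℂ | max s u < z.re} ∈ 𝓝 y := by
      refine hopen.mem_nhds ?_
      change _ < y.re
      rw [hyre]
      linarith [le_max_left (max s u) (max s' u')]
    refine eventually_nhdsWithin_of_eventually_nhds (Filter.mem_of_superset hmem fun z hz => ?_)
    have hz' : max s u < z.re := hz
    change F z - G z = 0
    rw [hFf z ((le_max_left _ _).trans_lt hz'), hGf z ((le_max_right _ _).trans_lt hz'), sub_self]
  have hz₀ : z₀ ∈ U := max_lt hs hu
  have htop : meromorphicOrderAt (F - G) z₀ = ⊤ := by
    by_contra hne
    exact hsub.meromorphicOrderAt_ne_top_of_isPreconnected hpre hz₀ hyU hne hytop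
  rw [meromorphicOrderAt_eq_top_iff] at htop
  filter_upwards [htop] with z hz
  exact sub_eq_zero.1 hz

theorem contResidue_eq_residue {f F : ℂ → ℂ} {z₀ : ℂ} (hF : IsMeromorphicContinuation f z₀ F) :
    contResidue f z₀ = residue F z₀ := by
  have h : ∃ F, IsMeromorphicContinuation f z₀ F := ⟨F, hF⟩
  rw [contResidue, dif_pos h]
  exact residue_congr (eventuallyEq_of_continuations h.choose_spec hF)

/-! ### Mellin transforms and small time expansions. -/

theorem locallyIntegrableOn_Ioc_power (w : ℂ) :
    LocallyIntegrableOn ((Ioc (0 : ℝ) 1).indicator fun t : ℝ => (t : ℂ) ^ w) (Ioi 0) := by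
  have h : LocallyIntegrableOn (fun t : ℝ => (t : ℂ) ^ w) (Ioi 0) := by
    refine ContinuousOn.locallyIntegrableOn (fun t ht => ?_) measurableSet_Ioi
    exact (continuousAt_ofReal_cpow_const _ _ (Or.inr (ne_of_gt ht))).continuousWithinAt
  intro x hx
  obtain ⟨u, hu, hi⟩ := h x hx
  exact ⟨u, hu, hi.indicator measurableSet_Ioc⟩

/-- Subtracting a finite sum of power functions on `(0, 1]` gives simple poles of the
Mellin transform. -/
theorem mellin_add_powers {ι : Type*} (J : Finset ι) (w : ι → ℂ) (b : ι → ℂ) {g : ℝ → ℂ} {z : ℂ}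
    (hg : MellinConvergent g z) (hz : ∀ j ∈ J, 0 < z.re + (w j).re) :
    mellin (fun t => g t + ∑ j ∈ J, b j * (Ioc (0 : ℝ) 1).indicator (fun t : ℝ => (t : ℂ) ^ w j) t) z
      = mellin g z + ∑ j ∈ J, b j / (z + w j) := by
  classical
  suffices h : HasMellin
      (fun t => g t + ∑ j ∈ J, b j * (Ioc (0 : ℝ) 1).indicator (fun t : ℝ => (t : ℂ) ^ w j) t) z
      (mellin g z + ∑ j ∈ J, b j / (z + w j)) from h.2
  induction J using Finset.induction_on with
  | empty =>
    simp only [Finset.sum_empty, add_zero]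
    exact ⟨hg, rfl⟩
  | insert j J hj ih =>
    have h1 := ih fun i hi => hz i (Finset.mem_insert_of_mem hi)
    have h2 := hasMellin_cpow_Ioc (w j) (hz j (Finset.mem_insert_self _ _))
    have h3 := hasMellin_add h1.1 (hasMellin_const_smul h2.1 (b j)).1
    simp only [Finset.sum_insert hj]
    convert h3 using 1
    · ext t
      simp only [smul_eq_mul]
      ring
    · rw [h1.2, mellin_const_smul, h2.2, smul_eq_mul, mul_one_div]
      ring

theorem locallyIntegrableOn_sum_powers {ι : Type*} (J : Finset ι) (w b : ι → ℂ) :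
    LocallyIntegrableOn (fun t : ℝ =>
      ∑ j ∈ J, b j * (Ioc (0 : ℝ) 1).indicator (fun t : ℝ => (t : ℂ) ^ w j) t) (Ioi 0) := by
  classical
  induction J using Finset.induction_on with
  | empty =>
    simp only [Finset.sum_empty]
    exact locallyIntegrableOn_zero
  | insert j J hj ih =>
    simp only [Finset.sum_insert hj]
    refine LocallyIntegrableOn.add (fun x hx => ?_) ih
    obtain ⟨u, hu, hi⟩ := locallyIntegrableOn_Ioc_power (w j) x hx
    exact ⟨u, hu, hi.const_mul (b j)⟩

/-- Cut off at `t = 1`, the power `t ^ w` has Mellin transform `1 / (z + w)`. The remainder is `O(t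
^ (-β))` at `0` and keeps the exponential decay, so its transform is holomorphic for `Re z > β`. -/
theorem exists_mellin_continuation {ι : Type*} (J : Finset ι) (w b : ι → ℂ) {h : ℝ → ℂ} {m β : ℝ}
    (hm : 0 < m) (hloc : LocallyIntegrableOn h (Ioi 0))
    (htop : h =O[atTop] fun t => Real.exp (-m * t))
    (hbot : (fun t : ℝ => h t - ∑ j ∈ J, b j * (t : ℂ) ^ w j) =O[𝓝[>] 0] fun t => t ^ (-β)) :
    ∃ g : ℂ → ℂ, (∀ z : ℂ, β < z.re → DifferentiableAt ℂ g z) ∧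
      ∃ σ : ℝ, ∀ z : ℂ, σ < z.re → mellin h z = g z + ∑ j ∈ J, b j / (z + w j) := by
  set q : ℝ → ℂ := fun t =>
    ∑ j ∈ J, b j * (Ioc (0 : ℝ) 1).indicator (fun t : ℝ => (t : ℂ) ^ w j) t with hq
  set g : ℝ → ℂ := fun t => h t - q t with hg
  have hgloc : LocallyIntegrableOn g (Ioi 0) := by
    refine hloc.sub ?_
    exact locallyIntegrableOn_sum_powers J w b
  have hgtop : g =O[atTop] fun t => Real.exp (-m * t) := by
    refine htop.congr' ?_ EventuallyEq.rfl
    filter_upwards [eventually_gt_atTop 1] with t ht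
    have : q t = 0 := Finset.sum_eq_zero fun j _ => by
      rw [indicator_of_notMem (fun h => ht.not_ge h.2), mul_zero]
    rw [hg]
    simp [this]
  have hgbot : g =O[𝓝[>] 0] fun t => t ^ (-β) := by
    refine hbot.congr' ?_ EventuallyEq.rfl
    filter_upwards [Ioo_mem_nhdsGT one_pos] with t ht
    rw [hg, hq]
    congr 1
    refine Finset.sum_congr rfl fun j _ => ?_
    rw [indicator_of_mem (s := Ioc (0 : ℝ) 1) ⟨ht.1, ht.2.le⟩]
  refine ⟨mellin g, fun z hz =>
    mellin_differentiableAt_of_isBigO_rpow_exp hm hgloc hgtop hgbot hz, ?_⟩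
  obtain ⟨B, hB⟩ := (J.image fun j => -(w j).re).bddAbove
  refine ⟨max β B, fun z hz => ?_⟩
  rw [← mellin_add_powers J w b
    (mellinConvergent_of_isBigO_rpow_exp hm hgloc hgtop hgbot ((le_max_left _ _).trans_lt hz))]
  · congr 1
    ext t
    simp [hg, hq]
  · intro j hj
    have : -(w j).re ≤ B := hB (by simpa using ⟨j, hj, rfl⟩)
    linarith [(le_max_right β B).trans_lt hz]

/-- The residue at `z₀` of a product of an entire function with a Mellin transform is given
by the coefficients of `t ^ (-z₀)` in the expansion at `0`. -/
theorem contResidue_mul_mellin {ι : Type*} (J : Finset ι) (w b : ι → ℂ) {f φ : ℂ → ℂ} {h : ℝ → ℂ}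
    {m β : ℝ} {z₀ : ℂ} (hm : 0 < m) (hβ : β < z₀.re) (hφ : Differentiable ℂ φ)
    (hloc : LocallyIntegrableOn h (Ioi 0))
    (htop : h =O[atTop] fun t => Real.exp (-m * t))
    (hbot : (fun t : ℝ => h t - ∑ j ∈ J, b j * (t : ℂ) ^ w j) =O[𝓝[>] 0] fun t => t ^ (-β))
    {σ : ℝ} (hf : ∀ z : ℂ, σ < z.re → f z = φ z * mellin h z) [DecidableEq ℂ] :
    contResidue f z₀ = φ z₀ * ∑ j ∈ J with w j = -z₀, b j := by
  obtain ⟨g, hg, σ', hσ'⟩ := exists_mellin_continuation J w b hm hloc htop hbot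
  have hopen : IsOpen {z : ℂ | β < z.re} := isOpen_lt continuous_const continuous_re
  have hgan : ∀ z : ℂ, β < z.re → AnalyticAt ℂ g z := fun z hz =>
    DifferentiableOn.analyticAt (s := {z : ℂ | β < z.re})
      (fun x hx => (hg x hx).differentiableWithinAt) (hopen.mem_nhds hz)
  have hcont : IsMeromorphicContinuation f z₀
      fun z => φ z * (g z + ∑ j ∈ J, b j / (z + w j)) := by
    refine ⟨max σ σ', β, hβ, fun z hz => ?_, fun z hz => ?_⟩
    · refine (hφ.analyticAt z).meromorphicAt.mul ((hgan z hz).meromorphicAt.add ?_)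
      refine MeromorphicAt.fun_sum fun j => ?_
      fun_prop
    · simp only
      rw [hf z ((le_max_left _ _).trans_lt hz), hσ' z ((le_max_right _ _).trans_lt hz)]
  rw [contResidue_eq_residue hcont]
  set c := ∑ j ∈ J with w j = -z₀, b j with hc
  -- `c φ(z) / (z - z₀)` splits into the polar part `c φ(z₀) / (z - z₀)` and the analytic part `c *
  -- dslope φ z₀ z`.
  refine residue_simple_pole
    (g := fun z => φ z * (g z + ∑ j ∈ J with ¬ w j = -z₀, b j / (z + w j)) + c * dslope φ z₀ z)
    ?_ ?_
  · have hsum : AnalyticAt ℂ (fun z => ∑ j ∈ J with ¬ w j = -z₀, b j / (z + w j)) z₀ := by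
      refine Finset.analyticAt_fun_sum _ fun j hj => ?_
      refine analyticAt_const.div (analyticAt_id.add analyticAt_const) fun h0 => ?_
      exact (Finset.mem_filter.1 hj).2 (eq_neg_of_add_eq_zero_right h0)
    have hds : AnalyticAt ℂ (dslope φ z₀) z₀ := by
      refine DifferentiableOn.analyticAt (s := univ) ?_ univ_mem
      exact (Complex.differentiableOn_dslope univ_mem).2 hφ.differentiableOn
    exact ((hφ.analyticAt z₀).mul ((hgan z₀ hβ).add hsum)).add (analyticAt_const.mul hds)
  · filter_upwards [self_mem_nhdsWithin] with z hz
    have hz' : z - z₀ ≠ 0 := sub_ne_zero.2 hz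
    rw [← Finset.sum_filter_add_sum_filter_not J (fun j => w j = -z₀)]
    have : ∑ j ∈ J with w j = -z₀, b j / (z + w j) = c / (z - z₀) := by
      rw [hc, Finset.sum_div]
      refine Finset.sum_congr rfl fun j hj => ?_
      rw [(Finset.mem_filter.1 hj).2, sub_eq_add_neg]
    rw [this, dslope_of_ne _ hz, slope_def_field]
    field_simp
    ring

/-- The residue of a product of an entire function with the Mellin transform of a function that
has, up to a constant, a small time expansion. -/
theorem contResidue_of_expansion {h : ℝ → ℂ} {N m : ℝ} {ψ : ℕ → ℂ} {c : ℂ} {f φ : ℂ → ℂ} {x : ℝ}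
    (hm : 0 < m) (hφ : Differentiable ℂ φ) (hloc : LocallyIntegrableOn h (Ioi 0))
    (htop : h =O[atTop] fun t => Real.exp (-m * t)) {k : ℝ → ℂ}
    (hexp : HasSmallTimeExpansion k N ψ) (hk : ∀ t, 0 < t → k t = h t + c)
    {σ : ℝ} (hf : ∀ z : ℂ, σ < z.re → f z = φ z * mellin h z) :
    contResidue f x = φ x * (coeffAt ψ (N - x) - if x = 0 then c else 0) := by
  classical
  -- With this many terms the remainder is `O(t ^ (M - N))`, so its transform is holomorphic at `x >
  -- N - M`.
  obtain ⟨M, hM⟩ := exists_nat_gt (N - x)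
  -- The index `none` carries the constant term `-c t^0` of `h = k - c`; it produces the pole at
  -- `0`.
  let w : Option ℕ → ℂ := fun o => o.elim 0 fun s => (((s : ℝ) - N : ℝ) : ℂ)
  let b : Option ℕ → ℂ := fun o => o.elim (-c) ψ
  have key := contResidue_mul_mellin (Finset.insertNone (Finset.range (M + 1))) w b
    (z₀ := (x : ℂ)) (β := N - M) hm (by simp; linarith) hφ hloc htop ?_ hf
  · rw [key, Finset.sum_filter, Finset.sum_insertNone]
    congr 1
    rw [add_comm, sub_eq_add_neg]
    congr 1
    · have hw : ∀ s : ℕ, w (some s) = -(x : ℂ) ↔ (s : ℝ) = N - x := fun s => by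
        simp only [w, Option.elim]
        norm_cast
        constructor <;> intro h <;> linarith
      simp only [hw, b, Option.elim]
      unfold coeffAt
      split_ifs with hN
      · rw [Finset.sum_eq_single ⌊N - x⌋₊]
        · rw [if_pos hN.symm]
        · intro s _ hs
          rw [if_neg]
          intro h
          exact hs (by rw [← h, Nat.floor_natCast])
        · intro h
          refine absurd (Finset.mem_range.2 ?_) h
          have : ((⌊N - x⌋₊ : ℕ) : ℝ) < M := hN ▸ hM
          have := Nat.cast_lt.1 this
          omega
      · refine Finset.sum_eq_zero fun s _ => if_neg fun h => hN ?_
        rw [← h, Nat.floor_natCast]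
    · by_cases hx : x = 0
      · have : w none = -(x : ℂ) := by simp [w, hx]
        rw [if_pos this, if_pos hx]
        rfl
      · have : ¬ w none = -(x : ℂ) := by
          rw [eq_comm, neg_eq_iff_eq_neg]
          simpa [w] using hx
        rw [if_neg this, if_neg hx, neg_zero]
  · refine (hexp M).isBigO.congr' ?_ (EventuallyEq.of_eq (by ext t; congr 1; ring))
    filter_upwards [self_mem_nhdsWithin] with t ht
    rw [Finset.sum_insertNone, hk t ht]
    simp only [w, b, Option.elim, cpow_zero]
    have : ∀ s : ℕ, (((t ^ ((s : ℝ) - N) : ℝ)) : ℂ) * ψ s =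
        ψ s * (t : ℂ) ^ (((s : ℝ) - N : ℝ) : ℂ) := fun s => by
      rw [ofReal_cpow (le_of_lt ht), mul_comm]
    simp only [this]
    ring

open Set MeasureTheory

/-! ### Extensions of `X Δ^{-z}`, `X e^{-tΔ}` and `X Π` to bounded operators. -/

section Extension

variable {H : Type*} [NormedAddCommGroup H] [InnerProductSpace ℂ H] [CompleteSpace H]
  {D : H →ₗ.[ℂ] H}

omit [CompleteSpace H] in
theorem extComp_eq {V : Submodule ℂ H} {X : Module.End ℂ V} {B S : H →L[ℂ] H}
    (hS : ExtendsComp X B S) (hd : Dense {v | B v ∈ V}) : extComp X B = S := by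
  have h : ∃ S : H →L[ℂ] H, ExtendsComp X B S := ⟨S, hS⟩
  rw [extComp, dif_pos h]
  refine DFunLike.coe_injective (Continuous.ext_on hd (by fun_prop) (by fun_prop) fun v hv => ?_)
  rw [h.choose_spec v hv, hS v hv]

/-- All later zeta values are expressed through one fixed operator `S`, by `Δ^{-z} = Δ^{-σ}
Δ^{-(z-σ)}`. -/
theorem extComp_cpowNeg (hD : IsSelfAdjoint D) (hF : IsFredholm D) {X : Module.End ℂ (smooth D)}
    {S : H →L[ℂ] H} {σ z : ℂ} (hσ : 0 < σ.re) (hz : σ.re < z.re)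
    (hS : ExtendsComp X (cpowNeg D σ) S) :
    extComp X (cpowNeg D z) = S * cpowNeg D (z - σ) := by
  have hmul : cpowNeg D σ * cpowNeg D (z - σ) = cpowNeg D z := by
    rw [cpowNeg_mul_cpowNeg hD hF hσ (by simpa using hz), add_sub_cancel]
  refine extComp_eq (fun v hv => ?_)
    ((dense_smooth hD hF).mono fun v hv => cpowNeg_mem_smooth hD hF z hv)
  rw [← hmul] at hv
  simp only [← hmul]
  exact hS _ hv

theorem extComp_heat (hD : IsSelfAdjoint D) (hF : IsFredholm D)
    [(kernel D).HasOrthogonalProjection] {X : Module.End ℂ (smooth D)} {S K : H →L[ℂ] H} {σ : ℕ}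
    (hσ : σ ≠ 0) (hS : ExtendsComp X (cpowNeg D σ) S)
    (hK : ExtendsComp X (kernel D).starProjection K) {t : ℝ} (ht : 0 < t) :
    extComp X (heat D t) = S * heatPow D σ t + K := by
  refine extComp_eq (fun v hv => ?_) (by simp [heat_mem_smooth hD hF ht])
  have h1 := cpowNeg_mul_heatPow hD hF hσ ht
  have hk : (kernel D).starProjection v ∈ smooth D :=
    kernel_le_smooth hD (Submodule.starProjection_apply_mem _ v)
  have h2 : cpowNeg D σ (heatPow D σ t v) = heat D t v - (kernel D).starProjection v :=
    congrArg (fun B : H →L[ℂ] H => B v) h1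
  have h3 : cpowNeg D σ (heatPow D σ t v) ∈ smooth D := h2 ▸ Submodule.sub_mem _ hv hk
  rw [add_apply, mul_apply_eq_comp, hS _ h3, hK v hk, ← Submodule.coe_add, ← map_add]
  congr 2
  exact Subtype.ext (by simp [h2])

/-- `ker D` is finite-dimensional and consists of smooth vectors, so `X Π` has finite rank. -/
theorem exists_kernel_part (hD : IsSelfAdjoint D) (hF : IsFredholm D)
    [(kernel D).HasOrthogonalProjection] (X : Module.End ℂ (smooth D)) :
    ∃ K : H →L[ℂ] H, ExtendsComp X (kernel D).starProjection K ∧ IsTraceClass K := by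
  have : FiniteDimensional ℂ (kernel D) := hF.1
  let f : kernel D →ₗ[ℂ] H :=
    (smooth D).subtype ∘ₗ X ∘ₗ Submodule.inclusion (kernel_le_smooth hD)
  let b := stdOrthonormalBasis ℂ (kernel D)
  refine ⟨f.toContinuousLinearMap ∘L (kernel D).orthogonalProjectionOnto, fun v hv => rfl,
    isTraceClass_of_finite_sum (fun i => f (b i)) (fun i => (b i : H)) fun v => ?_⟩
  change f ((kernel D).orthogonalProjectionOnto v) = _
  conv_lhs => rw [← b.sum_repr ((kernel D).orthogonalProjectionOnto v)]
  rw [map_sum]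
  refine Finset.sum_congr rfl fun i _ => ?_
  rw [map_smul, b.repr_apply_apply, Submodule.coe_inner]
  congr 1
  exact Submodule.inner_orthogonalProjectionOnto_eq_of_mem_left (b i) v

end Extension

/-! ### Heat supertraces, zeta functions and their residues. -/

namespace EvenSpectralTriple

variable {A H : Type*} [NonUnitalRing A] [Module ℂ A]
  [NormedAddCommGroup H] [InnerProductSpace ℂ H] [CompleteSpace H]
  {T : EvenSpectralTriple A H}

/-- Up to the constant `Tr_s(X Π)`, the heat supertrace is a function whose Mellin transform
is `Γ(z) Tr_s(X Δ^{-z})`. -/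
theorem exists_mellin_eq_gamma_mul_superZeta (hD : IsFredholm T.D)
    {X : Module.End ℂ (smooth T.D)} {K : H →L[ℂ] H} (hK : ExtendsComp X T.kerProj K)
    (hKt : IsTraceClass K) {σ : ℕ} (hσ : σ ≠ 0)
    (hX : ∃ S : H →L[ℂ] H, ExtendsComp X (cpowNeg T.D σ) S ∧ IsTraceClass S) :
    ∃ (h : ℝ → ℂ) (m : ℝ), 0 < m ∧ LocallyIntegrableOn h (Ioi 0) ∧
      (h =O[atTop] fun t => Real.exp (-m * t)) ∧
      (∀ t, 0 < t → T.heatSuperTrace X t = h t + T.superTrace K) ∧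
      ∀ z : ℂ, σ < z.re → Complex.Gamma z * T.superZeta X z = mellin h z := by
  obtain ⟨S, hS, hSt⟩ := hX
  obtain ⟨L, hL⟩ := exists_clm_opTrace hSt T.γ
  have hTD := T.D_selfAdjoint
  have hσ' : 0 < ((σ : ℂ)).re := by simpa using Nat.pos_of_ne_zero hσ
  obtain ⟨C, m, hm, hle⟩ := exists_norm_heatPow_le hTD hD hσ
  have hint : ∀ z : ℂ, σ < z.re → IntegrableOn
      (fun t : ℝ => (t : ℂ) ^ (z - 1) • L (heatPow T.D σ t)) (Ioi 0) := fun z hz => by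
    have := L.integrable_comp (mellin_heatPow hTD hD hσ hz).1
    simpa [IntegrableOn] using this
  refine ⟨fun t => L (heatPow T.D σ t), m, hm, ?_, ?_, fun t ht => ?_, fun z hz => ?_⟩
  · have hloc := (hint ((σ : ℂ) + 1) (by simp)).locallyIntegrableOn
    have hc : ContinuousOn (fun t : ℝ => (t : ℂ) ^ (-(σ : ℂ))) (Ioi 0) := fun t ht =>
      (Complex.continuousAt_ofReal_cpow_const _ _ (Or.inr (ne_of_gt ht))).continuousWithinAt
    have h2 := hloc.continuousOn_mul hc isOpen_Ioi.isLocallyClosed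
    intro x hx
    obtain ⟨u, hu, hi⟩ := h2 x hx
    refine ⟨u ∩ Ioi 0, inter_mem hu self_mem_nhdsWithin, ?_⟩
    refine IntegrableOn.congr_fun_ae (hi.mono_set inter_subset_left) ?_
    refine ae_restrict_of_ae_restrict_of_subset inter_subset_right
      (ae_restrict_of_forall_mem measurableSet_Ioi fun t ht => ?_)
    have ht0 : (t : ℂ) ≠ 0 := by exact_mod_cast ne_of_gt (mem_Ioi.1 ht)
    simp only [add_sub_cancel_right, smul_eq_mul, Complex.cpow_neg]
    rw [inv_mul_cancel_left₀]
    exact fun h => ht0 (Complex.cpow_eq_zero_iff _ _ |>.1 h).1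
  · refine IsBigO.of_bound (‖L‖ * |C|) ?_
    filter_upwards [eventually_ge_atTop 1] with t ht
    have ht0 : 0 < t := one_pos.trans_le ht
    have h1 : t ^ (-(σ : ℝ)) ≤ 1 := Real.rpow_le_one_of_one_le_of_nonpos ht (by simp)
    calc ‖L (heatPow T.D σ t)‖ ≤ ‖L‖ * ‖heatPow T.D σ t‖ := L.le_opNorm _
      _ ≤ ‖L‖ * (|C| * (1 * Real.exp (-m * t))) := by
        gcongr
        refine (hle t ht0).trans ?_
        gcongr
        exact le_abs_self C
      _ = ‖L‖ * |C| * ‖Real.exp (-m * t)‖ := by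
        rw [Real.norm_of_nonneg (Real.exp_pos _).le]
        ring
  · have h1 := hSt.mul_mul T.γ (heatPow T.D σ t)
    have h2 := hKt.mul_mul T.γ 1
    rw [mul_one] at h2
    rw [heatSuperTrace, extComp_heat hTD hD hσ hS hK ht, superTrace, mul_add, ← mul_assoc,
      opTrace_add h1 h2, ← hL, superTrace]
  · rw [superZeta, extComp_cpowNeg hTD hD hσ' (by simpa using hz) hS, superTrace, ← mul_assoc,
      ← hL, ← smul_eq_mul, ← map_smul, ← (mellin_heatPow hTD hD hσ hz).2,
      ← L.integral_comp_comm (mellin_heatPow hTD hD hσ hz).1, mellin]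
    simp only [map_smul]

/-- At `z = 0` the removed constant contributes `-Tr_s(X Π)` to the residue, which the added
supertrace cancels. -/
theorem contResidue_gamma_mul_superZeta (hD : IsFredholm T.D)
    {X : Module.End ℂ (smooth T.D)} {K : H →L[ℂ] H} (hK : ExtendsComp X T.kerProj K)
    (hKt : IsTraceClass K) {σ : ℕ} (hσ : σ ≠ 0)
    (hX : ∃ S : H →L[ℂ] H, ExtendsComp X (cpowNeg T.D σ) S ∧ IsTraceClass S)
    {N : ℝ} {ψ : ℕ → ℂ} (hexp : HasSmallTimeExpansion (T.heatSuperTrace X) N ψ) :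
    contResidue (fun z => Complex.Gamma z * T.superZeta X z) 0 + T.superTrace K =
      coeffAt ψ N := by
  obtain ⟨h, m, hm, hloc, htop, hk, hmel⟩ :=
    exists_mellin_eq_gamma_mul_superZeta hD hK hKt hσ hX
  have := contResidue_of_expansion (φ := fun _ => 1) (x := 0) hm (differentiable_const _) hloc htop
    hexp hk (σ := σ) (f := fun z => Complex.Gamma z * T.superZeta X z)
    fun z hz => by rw [hmel z hz, one_mul]
  rw [Complex.ofReal_zero] at this
  rw [this]
  simp

/-- `1/Γ` is entire, so dividing by `Γ` adds no poles. As `x > 0`, the pole due to the kernel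
constant is not seen. -/
theorem contResidue_superZeta (hD : IsFredholm T.D)
    {X : Module.End ℂ (smooth T.D)} {σ : ℕ} (hσ : σ ≠ 0)
    (hX : ∃ S : H →L[ℂ] H, ExtendsComp X (cpowNeg T.D σ) S ∧ IsTraceClass S)
    {N x : ℝ} {ψ : ℕ → ℂ} (hexp : HasSmallTimeExpansion (T.heatSuperTrace X) N ψ) (hx : 0 < x) :
    contResidue (T.superZeta X) x = (Complex.Gamma x)⁻¹ * coeffAt ψ (N - x) := by
  obtain ⟨K, hK, hKt⟩ := exists_kernel_part T.D_selfAdjoint hD X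
  obtain ⟨h, m, hm, hloc, htop, hk, hmel⟩ :=
    exists_mellin_eq_gamma_mul_superZeta hD hK hKt hσ hX
  rw [contResidue_of_expansion (φ := fun z => (Complex.Gamma z)⁻¹) hm
    Complex.differentiable_one_div_Gamma hloc htop hexp hk (σ := σ), if_neg hx.ne', sub_zero]
  intro z hz
  rw [← hmel z hz, inv_mul_cancel_left₀]
  exact Complex.Gamma_ne_zero_of_re_pos ((Nat.cast_nonneg σ).trans_lt hz)

variable {hA : T.PreservesSmooth}

/-- Membership gives `P_k` a finite order in the filtration, hence a `σ` with `P_k Δ^{-σ}` trace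
class. -/
theorem opP_mem_diffAlg {p : ℕ} (k : Fin p → ℕ) (a : Fin (p + 1) → A) :
    opP hA k a ∈ diffAlg hA := by
  rw [diffAlg, NonUnitalAlgebra.mem_sInf]
  rintro S ⟨h1, h2, h3⟩
  have hmul : ∀ (l : List (Module.End ℂ (smooth T.D))) (Y : Module.End ℂ (smooth T.D)),
      Y ∈ S → (∀ Z ∈ l, Z ∈ S) → Y * l.prod ∈ S := by
    intro l
    induction l with
    | nil => intro Y hY _; simpa using hY
    | cons Z l ih =>
      intro Y hY hl
      rw [List.prod_cons, ← mul_assoc]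
      exact ih _ (mul_mem hY (hl Z List.mem_cons_self)) fun W hW => hl W (List.mem_cons_of_mem _ hW)
  refine hmul _ _ (h1 _) fun Z hZ => ?_
  obtain ⟨i, rfl⟩ := List.mem_ofFn.1 hZ
  induction k i with
  | zero => exact h2 _
  | succ l ih =>
    rw [Function.iterate_succ_apply']
    exact h3 _ ih

end EvenSpectralTriple

end ResidueCocycle

end

/-! ### The residue cocycle in terms of heat coefficients. -/

theorem propositionp {A H : Type*} [NonUnitalRing A] [Module ℂ A] [IsScalarTower ℂ A A]
    [SMulCommClass ℂ A A] [NormedAddCommGroup H] [InnerProductSpace ℂ H] [CompleteSpace H]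
    (T : ResidueCocycle.EvenSpectralTriple A H)
    (hD : ResidueCocycle.IsFredholm T.D)
    (hA : T.PreservesSmooth)
    (r : ℕ) (F : ℕ → Submodule ℂ (Module.End ℂ (ResidueCocycle.smooth T.D)))
    (hF : ResidueCocycle.EvenSpectralTriple.IsOrderFiltration hA r F)
    (n : ℝ) (hn : T.HasAnalyticDimension r F n)
    (hcont : T.AnalyticContinuationProperty r F n)
    (p : ℕ) (hp : Even p) (hpn : (p : ℝ) ≤ n) (a : Fin (p + 1) → A)
    (N : (Fin p → ℕ) → ℝ) (ψ : (Fin p → ℕ) → ℕ → ℂ)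
    (hexp : ∀ k : Fin p → ℕ, ((∑ i, k i : ℕ) : ℝ) ≤ n - p →
      ResidueCocycle.HasSmallTimeExpansion
        (T.heatSuperTrace (ResidueCocycle.EvenSpectralTriple.opP hA k a)) (N k) (ψ k)) :
    ResidueCocycle.residueCocycle hA n p a =
      ∑ k ∈ ResidueCocycle.multiIndices p n, ResidueCocycle.cPrime k *
        ResidueCocycle.coeffAt (ψ k) (N k - (p : ℝ) / 2 - (∑ i, k i : ℕ)) := by
  open ResidueCocycle EvenSpectralTriple in
  have htr : ∀ k : Fin p → ℕ, ∃ σ : ℕ, σ ≠ 0 ∧ ∃ S : H →L[ℂ] H,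
      ExtendsComp (opP hA k a) (cpowNeg T.D σ) S ∧ IsTraceClass S := by
    intro k
    obtain ⟨q, hq⟩ := (hF.exhaust _).1 (opP_mem_diffAlg (hA := hA) k a)
    obtain ⟨σ, hσ⟩ := exists_nat_gt (((q : ℝ) + n) / r)
    have h0 : 0 ≤ ((q : ℝ) + n) / r := by have := hn.1.1; positivity
    have hσ0 : (0 : ℝ) < σ := h0.trans_lt hσ
    exact ⟨σ, by rintro rfl; simp at hσ0, hn.1.2 q _ hq σ (by simpa using hσ)⟩
  rcases p with _ | p
  -- For `p = 0` only the empty multi-index occurs; it is admitted because `0 ≤ n`, and its `c'` is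
  -- `1`.
  · have hk : ∀ k : Fin 0 → ℕ, k ∈ ResidueCocycle.multiIndices 0 n := fun k => by
      rw [ResidueCocycle.mem_multiIndices]
      simpa using hpn
    have hP : ResidueCocycle.EvenSpectralTriple.opP hA (default : Fin 0 → ℕ) a =
        ResidueCocycle.EvenSpectralTriple.aOp hA (a 0) := by
      simp [ResidueCocycle.EvenSpectralTriple.opP]
    obtain ⟨σ, hσ, hS⟩ := htr default
    have hs : ResidueCocycle.multiIndices 0 n = {default} :=
      Finset.eq_singleton_iff_unique_mem.2 ⟨hk _, fun _ _ => Subsingleton.elim _ _⟩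
    have he := hexp default ((ResidueCocycle.mem_multiIndices).1 (hk _))
    obtain ⟨K, hK, hKt⟩ := ResidueCocycle.exists_kernel_part T.D_selfAdjoint hD
      (ResidueCocycle.EvenSpectralTriple.opP hA default a)
    have hKa : K = T.π (a 0) * T.kerProj := by
      ext v
      rw [hK v (ResidueCocycle.kernel_le_smooth T.D_selfAdjoint
        (Submodule.starProjection_apply_mem _ v)), hP]
      rfl
    have := ResidueCocycle.EvenSpectralTriple.contResidue_gamma_mul_superZeta hD hK hKt hσ hS he
    rw [hP, hKa] at this
    rw [hs, Finset.sum_singleton, ResidueCocycle.residueCocycle, this]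
    simp [ResidueCocycle.cPrime]
  · rw [ResidueCocycle.residueCocycle]
    refine Finset.sum_congr rfl fun k hk => ?_
    obtain ⟨σ, hσ, hS⟩ := htr k
    have he := hexp k (ResidueCocycle.mem_multiIndices.1 hk)
    have hx : (0 : ℝ) < ((p + 1 : ℕ) : ℝ) / 2 + (∑ i, k i : ℕ) := by positivity
    have key := ResidueCocycle.EvenSpectralTriple.contResidue_superZeta hD hσ hS he hx
    have hcast : (((((p + 1 : ℕ) : ℝ) / 2 + (∑ i, k i : ℕ) : ℝ)) : ℂ) =
        ((p + 1 : ℕ) : ℂ) / 2 + (∑ i, k i : ℕ) := by push_cast; ring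
    have hG : Complex.Gamma (((p + 1 : ℕ) : ℂ) / 2 + (∑ i, k i : ℕ)) ≠ 0 := by
      rw [← hcast]
      exact Complex.Gamma_ne_zero_of_re_pos (by simpa using hx)
    rw [hcast] at key
    rw [key, sub_sub, ResidueCocycle.cConst, ResidueCocycle.cPrime]
    -- The value of `Γ` enters only through `G * G⁻¹ = 1`, which takes `c_{pk}` to `c'_{pk}`.
    generalize Complex.Gamma _ = G at hG ⊢
    field_simp
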